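/- Let $H,K\in(0,1)$ and let $B^{H,K}=(B^{H,K}_t)_{t\ge 0}$ be a bifractional Brownian motion, that is, a centered Gaussian process with (almost surely) continuous paths and covariance $$E\left(B^{H,K}_sB^{H,K}_t\right)=\frac{1}{2^K}\left(\left(t^{2H}+s^{2H}\right)^K-|t-s|^{2HK}\right),\qquad s,t\ge 0.$$ Let $\theta>0$ and let $X=(X_t)_{t\ge0}$ be the Ornstein–Uhlenbeck process driven by $B^{H,K}$, that is, the continuous solution of $X_0=0$, $dX_t=-\theta X_t\,dt+dB^{H,K}_t$, understood as $X_t=-\theta\int_0^tX_s\,ds+B^{H,K}_t$ for all $t\ge0$, almost surely. **Theorem.** Let $\theta>0$ and $H,K\in(0,1)$ with $HK\neq\frac12$. Then $X_t$ is square integrable for every $t\ge 0$, and there exists a constant $C>0$ depending only on $\theta$ and $H$ such that for all $t>2$, $$\left|E\left[X_t^2\right]-\frac{HK\,\Gamma(2HK)}{2^{K-1}\theta^{2HK}}\right|\le C\,t^{2HK-2},$$ and for all $s,t\ge0$ with $|t-s|>2$, $$E\left(X_tX_s\right)\le C\begin{cases}|t-s|^{2HK-2H-1}&\text{if }0<H<\frac12,\\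 |t-s|^{2HK-2}&\text{if }\frac12\le H<1.\end{cases}$$ -/

import Mathlib

open MeasureTheory ProbabilityTheory
open scoped NNReal

/-- `B = (B_t)_{t ≥ 0}` is a bifractional Brownian motion with parameters `H` and `K` under `P`:
a centered Gaussian process with covariance
`E[B_s B_t] = 2^{-K} ((t^{2H} + s^{2H})^K - |t - s|^{2HK})`, taken, as usual, in a version with
almost surely continuous paths. -/
structure IsBifractionalBrownianMotion {Ω : Type*} [MeasurableSpace Ω]
    (H K : ℝ) (B : ℝ≥0 → Ω → ℝ) (P : Measure Ω) : Prop where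
  isGaussianProcess : IsGaussianProcess B P
  integral_eq_zero : ∀ t : ℝ≥0, ∫ ω, B t ω ∂P = 0
  integral_mul : ∀ s t : ℝ≥0, ∫ ω, B s ω * B t ω ∂P =
    1 / (2 : ℝ) ^ K * (((t : ℝ) ^ (2 * H) + (s : ℝ) ^ (2 * H)) ^ K
      - |(t : ℝ) - (s : ℝ)| ^ (2 * H * K))
  continuous_paths : ∀ᵐ ω ∂P, Continuous fun t : ℝ≥0 => B t ω

/-- `X = (X_t)_{t ≥ 0}` is the (pathwise, continuous) solution of the Langevin equation
`X_0 = 0`, `dX_t = -θ X_t dt + dG_t`, that is, almost surely `X` has continuous paths and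
`X_t = -θ ∫_0^t X_s ds + G_t` for all `t ≥ 0`. -/
structure IsOrnsteinUhlenbeck {Ω : Type*} [MeasurableSpace Ω]
    (θ : ℝ) (G X : ℝ≥0 → Ω → ℝ) (P : Measure Ω) : Prop where
  initial : ∀ᵐ ω ∂P, X 0 ω = 0
  continuous_paths : ∀ᵐ ω ∂P, Continuous fun t : ℝ≥0 => X t ω
  integral_equation : ∀ᵐ ω ∂P, ∀ t : ℝ≥0,
    X t ω = -θ * (∫ s in (0 : ℝ)..(t : ℝ), X s.toNNReal ω) + G t ω

/-! Variation of constants gives X_t = ∫_0^t e^{-θ(t-u)} dB_u, read pathwise by parts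
(`langevin_eq_ouOp`). Applying Fubini twice, E[X_t X_s] is 2^{-K} times the double integral of
e^{-θ(t-u)} e^{-θ(s-v)} against the rectangle increments of (u^{2H} + v^{2H})^K and of -|u-v|^a,
with a = 2HK (`IsOrnsteinUhlenbeck.integral_mul`). One tool replaces differentiation: if all
rectangle increments of a kernel are at most M times the area, the double integral is at most M/θ²
(`ouOp_ouOp_le`).

The first kernel has nonpositive increments, so it only helps in upper bounds. For the variance it
is also O(t^{a-2}) from below: on [t/2, t]² its mixed derivative has that order, and the rest of the
square is exponentially damped.

The second kernel is stationary. On the diagonal s = t it has a closed form, an incomplete gamma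
integral plus an exponentially small term, converging to aΓ(a)/θ^a. For s < t, the part u ≤ s
carries the factor e^{-θ(t-s)}. On u ≥ s ≥ v the mixed derivative is a(a-1)(u-v)^{a-2}: nonpositive
if a ≤ 1, and if a ≥ 1 of order (t-s)^{a-2} once a damped strip next to the diagonal is removed.

Thus E[X_t X_s] = O(|t-s|^{2HK-2}) from above for every H; when H < 1/2 the claimed exponent
2HK-2H-1 is larger, hence weaker. All constants depend on θ alone. -/

/-! ### The operator `ouOp` and its order bounds -/

/-- The integral `∫_s^t e^{-θ (t - u)} df(u)`, written through integration by parts. -/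
noncomputable def ouOp (θ s t : ℝ) (f : ℝ → ℝ) : ℝ :=
  f t - Real.exp (-θ * (t - s)) * f s - θ * ∫ u in s..t, Real.exp (-θ * (t - u)) * f u

theorem ouOp_congr {θ s t : ℝ} {f g : ℝ → ℝ} (hst : s ≤ t) (h : ∀ u ∈ Set.Icc s t, f u = g u) :
    ouOp θ s t f = ouOp θ s t g := by
  unfold ouOp
  rw [h t ⟨hst, le_rfl⟩, h s ⟨le_rfl, hst⟩, intervalIntegral.integral_congr]
  intro u hu
  rw [Set.uIcc_of_le hst] at hu
  simp only [h u hu]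

theorem intervalIntegrable_exp_mul {f : ℝ → ℝ} (hf : Continuous f) (θ t a b : ℝ) :
    IntervalIntegrable (fun u => Real.exp (-θ * (t - u)) * f u) volume a b :=
  Continuous.intervalIntegrable (by fun_prop) _ _

theorem ouOp_add {f g : ℝ → ℝ} (hf : Continuous f) (hg : Continuous g) (θ s t : ℝ) :
    ouOp θ s t (fun u => f u + g u) = ouOp θ s t f + ouOp θ s t g := by
  unfold ouOp
  simp only [mul_add]
  rw [intervalIntegral.integral_add (intervalIntegrable_exp_mul hf _ _ _ _)
    (intervalIntegrable_exp_mul hg _ _ _ _)]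
  ring

theorem ouOp_const_mul (c : ℝ) (f : ℝ → ℝ) (θ s t : ℝ) :
    ouOp θ s t (fun u => c * f u) = c * ouOp θ s t f := by
  unfold ouOp
  simp only [mul_left_comm _ c]
  rw [intervalIntegral.integral_const_mul]
  ring

theorem ouOp_neg (f : ℝ → ℝ) (θ s t : ℝ) :
    ouOp θ s t (fun u => -f u) = -ouOp θ s t f := by
  simpa using ouOp_const_mul (-1) f θ s t

theorem ouOp_sub {f g : ℝ → ℝ} (hf : Continuous f) (hg : Continuous g) (θ s t : ℝ) :
    ouOp θ s t (fun u => f u - g u) = ouOp θ s t f - ouOp θ s t g := by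
  simp only [sub_eq_add_neg, ← ouOp_neg]
  exact ouOp_add hf hg.neg θ s t

/-- Total mass of the kernel: for θ > 0 and s ≤ t, `ouOp θ s t f` is f(t) minus a weighted average
of f over [s, t]. The order bounds below come from this. -/
theorem integral_exp_mul_sub (θ s t : ℝ) :
    θ * ∫ u in s..t, Real.exp (-θ * (t - u)) = 1 - Real.exp (-θ * (t - s)) := by
  rw [← intervalIntegral.integral_const_mul]
  have h := intervalIntegral.integral_eq_sub_of_hasDerivAt (a := s) (b := t)
    (f := fun u => Real.exp (-θ * (t - u))) (f' := fun u => θ * Real.exp (-θ * (t - u)))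
    (fun u _ => by
      refine (((hasDerivAt_id' u).const_sub t).const_mul (-θ)).exp.congr_deriv ?_
      ring) (Continuous.intervalIntegrable (by fun_prop) _ _)
  rw [h]; simp

/-- The factor e^{-θ(t-m)} on the older piece is the source of all damping used later. -/
theorem ouOp_split {f : ℝ → ℝ} (hf : Continuous f) (θ s m t : ℝ) :
    ouOp θ s t f = Real.exp (-θ * (t - m)) * ouOp θ s m f + ouOp θ m t f := by
  unfold ouOp
  rw [← intervalIntegral.integral_add_adjacent_intervals
    (intervalIntegrable_exp_mul hf θ t s m) (intervalIntegrable_exp_mul hf θ t m t)]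
  have h1 : ∫ u in s..m, Real.exp (-θ * (t - u)) * f u
      = Real.exp (-θ * (t - m)) * ∫ u in s..m, Real.exp (-θ * (m - u)) * f u := by
    rw [← intervalIntegral.integral_const_mul]
    congr 1; ext u
    rw [← mul_assoc, ← Real.exp_add]; congr 2; ring
  have h2 : Real.exp (-θ * (t - s)) = Real.exp (-θ * (t - m)) * Real.exp (-θ * (m - s)) := by
    rw [← Real.exp_add]; congr 1; ring
  rw [h1, h2]; ring

theorem integral_exp_mul_le {θ s t M : ℝ} {f : ℝ → ℝ} (hθ : 0 < θ) (hst : s ≤ t)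
    (hf : Continuous f) (h : ∀ u ∈ Set.Icc s t, f u ≤ M) :
    θ * ∫ u in s..t, Real.exp (-θ * (t - u)) * f u ≤ (1 - Real.exp (-θ * (t - s))) * M := by
  rw [← integral_exp_mul_sub, mul_assoc, ← intervalIntegral.integral_mul_const]
  refine mul_le_mul_of_nonneg_left ?_ hθ.le
  refine intervalIntegral.integral_mono_on hst (intervalIntegrable_exp_mul hf _ _ _ _)
    (Continuous.intervalIntegrable (by fun_prop) _ _) fun u hu => ?_
  exact mul_le_mul_of_nonneg_left (h u hu) (Real.exp_pos _).le

theorem le_integral_exp_mul {θ s t M : ℝ} {f : ℝ → ℝ} (hθ : 0 < θ) (hst : s ≤ t)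
    (hf : Continuous f) (h : ∀ u ∈ Set.Icc s t, M ≤ f u) :
    (1 - Real.exp (-θ * (t - s))) * M ≤ θ * ∫ u in s..t, Real.exp (-θ * (t - u)) * f u := by
  have := integral_exp_mul_le (M := -M) (f := fun u => -f u) hθ hst hf.neg
    fun u hu => neg_le_neg (h u hu)
  simp only [mul_neg, intervalIntegral.integral_neg] at this
  linarith

theorem ouOp_nonneg {θ s t : ℝ} {f : ℝ → ℝ} (hθ : 0 < θ) (hst : s ≤ t) (hf : Continuous f)
    (h : MonotoneOn f (Set.Icc s t)) : 0 ≤ ouOp θ s t f := by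
  have h1 := integral_exp_mul_le hθ hst hf (M := f t) fun u hu => h hu ⟨hst, le_rfl⟩ hu.2
  have h2 := mul_le_mul_of_nonneg_left (h ⟨le_rfl, hst⟩ ⟨hst, le_rfl⟩ hst)
    (Real.exp_pos (-θ * (t - s))).le
  unfold ouOp; linarith

theorem ouOp_le_sub {θ s t : ℝ} {f : ℝ → ℝ} (hθ : 0 < θ) (hst : s ≤ t) (hf : Continuous f)
    (h : MonotoneOn f (Set.Icc s t)) : ouOp θ s t f ≤ f t - f s := by
  have h1 := le_integral_exp_mul hθ hst hf (M := f s) fun u hu => h ⟨le_rfl, hst⟩ hu hu.1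
  unfold ouOp; linarith

theorem exp_neg_mul_sub_le_one {θ s t : ℝ} (hθ : 0 < θ) (hst : s ≤ t) :
    Real.exp (-θ * (t - s)) ≤ 1 := by
  rw [Real.exp_le_one_iff]
  have := mul_nonneg hθ.le (sub_nonneg.2 hst)
  linarith

theorem ouOp_le {θ s t M : ℝ} {f : ℝ → ℝ} (hθ : 0 < θ) (hst : s ≤ t) (hf : Continuous f)
    (h : ∀ u ∈ Set.Icc s t, |f u| ≤ M) : ouOp θ s t f ≤ 2 * M := by
  have h1 := le_integral_exp_mul hθ hst hf (M := -M) fun u hu => (abs_le.1 (h u hu)).1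
  have h2 := mul_le_mul_of_nonneg_left (abs_le.1 (h s ⟨le_rfl, hst⟩)).1
    (Real.exp_pos (-θ * (t - s))).le
  have h3 := (abs_le.1 (h t ⟨hst, le_rfl⟩)).2
  unfold ouOp; linarith

theorem abs_ouOp_le {θ s t M : ℝ} {f : ℝ → ℝ} (hθ : 0 < θ) (hst : s ≤ t) (hf : Continuous f)
    (h : ∀ u ∈ Set.Icc s t, |f u| ≤ M) : |ouOp θ s t f| ≤ 2 * M := by
  refine abs_le.2 ⟨?_, ouOp_le hθ hst hf h⟩
  have := ouOp_le (f := fun u => -f u) hθ hst hf.neg (by simpa using h)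
  rw [ouOp_neg] at this; linarith

theorem ouOp_id_le {θ : ℝ} (hθ : 0 < θ) (s t : ℝ) : ouOp θ s t (fun u => u) ≤ 1 / θ := by
  have h := intervalIntegral.integral_eq_sub_of_hasDerivAt (a := s) (b := t)
    (f := fun u => Real.exp (-θ * (t - u)) * (u - 1 / θ))
    (f' := fun u => θ * (Real.exp (-θ * (t - u)) * u))
    (fun u _ => by
      refine ((((hasDerivAt_id' u).const_sub t).const_mul (-θ)).exp.mul
        ((hasDerivAt_id' u).sub_const (1 / θ))).congr_deriv ?_
      field_simp; ring) (Continuous.intervalIntegrable (by fun_prop) _ _)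
  rw [intervalIntegral.integral_const_mul] at h
  unfold ouOp
  rw [h]
  have : 0 ≤ Real.exp (-θ * (t - s)) * (1 / θ) := by positivity
  simp only [sub_self, mul_zero, Real.exp_zero]
  linarith

/-- The function Mu - f(u) is monotone, and ∫ e^{-θ(t-u)} du ≤ 1/θ. A one-sided bound on increments
suffices. -/
theorem ouOp_le_of_sub_le {θ s t M : ℝ} {f : ℝ → ℝ} (hθ : 0 < θ) (hst : s ≤ t) (hM : 0 ≤ M)
    (hf : Continuous f)
    (h : ∀ u ∈ Set.Icc s t, ∀ v ∈ Set.Icc s t, u ≤ v → f v - f u ≤ M * (v - u)) :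
    ouOp θ s t f ≤ M / θ := by
  have h1 : 0 ≤ ouOp θ s t (fun u => M * u - f u) :=
    ouOp_nonneg hθ hst (by fun_prop) fun u hu v hv huv => by
      have := h u hu v hv huv
      linarith
  rw [ouOp_sub (by fun_prop) hf, ouOp_const_mul] at h1
  have := mul_le_mul_of_nonneg_left (ouOp_id_le hθ s t) hM
  rw [mul_one_div] at this
  linarith

/-! ### Double integrals against rectangle increments -/

theorem continuous_ouOp {h : ℝ → ℝ → ℝ} (hh : Continuous fun p : ℝ × ℝ => h p.1 p.2)
    (θ s t : ℝ) : Continuous fun u => ouOp θ s t (h u) := by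
  unfold ouOp
  have h1 : ∀ v, Continuous fun u => h u v := fun v =>
    hh.comp (by fun_prop : Continuous fun u : ℝ => (u, v))
  have h2 : Continuous fun u => ∫ v in s..t, Real.exp (-θ * (t - v)) * h u v := by
    apply intervalIntegral.continuous_parametric_intervalIntegral_of_continuous'
    unfold Function.uncurry
    fun_prop
  have := h1 t
  have := h1 s
  fun_prop

/-- Plays the role of the hypothesis ∂_u∂_v h ≤ M, without differentiability. The one-variable bound
is applied to h(u₂, ·) - h(u₁, ·), then to the resulting function of u. -/
theorem ouOp_ouOp_le {θ s t s' t' M : ℝ} {h : ℝ → ℝ → ℝ} (hθ : 0 < θ) (hst : s ≤ t)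
    (hst' : s' ≤ t') (hM : 0 ≤ M) (hh : Continuous fun p : ℝ × ℝ => h p.1 p.2)
    (H : ∀ u₁ ∈ Set.Icc s t, ∀ u₂ ∈ Set.Icc s t, u₁ ≤ u₂ → ∀ v₁ ∈ Set.Icc s' t',
      ∀ v₂ ∈ Set.Icc s' t', v₁ ≤ v₂ →
      (h u₂ v₂ - h u₁ v₂) - (h u₂ v₁ - h u₁ v₁) ≤ M * (u₂ - u₁) * (v₂ - v₁)) :
    ouOp θ s t (fun u => ouOp θ s' t' (h u)) ≤ M / θ ^ 2 := by
  have hc : ∀ u, Continuous (h u) := fun u =>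
    hh.comp (by fun_prop : Continuous fun v : ℝ => (u, v))
  have : M / θ ^ 2 = M / θ / θ := by field_simp
  rw [this]
  refine ouOp_le_of_sub_le hθ hst (by positivity) (continuous_ouOp hh _ _ _)
    fun u₁ hu₁ u₂ hu₂ hu => ?_
  rw [← ouOp_sub (hc _) (hc _)]
  refine (ouOp_le_of_sub_le hθ hst' (mul_nonneg hM (sub_nonneg.2 hu)) ((hc _).sub (hc _))
    fun v₁ hv₁ v₂ hv₂ hv => H u₁ hu₁ u₂ hu₂ hu v₁ hv₁ v₂ hv₂ hv).trans (le_of_eq ?_)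
  ring

theorem ouOp_ouOp_split {h : ℝ → ℝ → ℝ} (hh : Continuous fun p : ℝ × ℝ => h p.1 p.2)
    (θ s t s' m t' : ℝ) :
    ouOp θ s t (fun u => ouOp θ s' t' (h u)) =
      Real.exp (-θ * (t' - m)) * ouOp θ s t (fun u => ouOp θ s' m (h u))
        + ouOp θ s t (fun u => ouOp θ m t' (h u)) := by
  have hc : ∀ u, Continuous (h u) := fun u =>
    hh.comp (by fun_prop : Continuous fun v : ℝ => (u, v))
  simp only [ouOp_split (hc _) θ s' m t']
  rw [ouOp_add ((continuous_ouOp hh _ _ _).const_mul _) (continuous_ouOp hh _ _ _), ouOp_const_mul]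

theorem ouOp_ouOp_neg (h : ℝ → ℝ → ℝ) (θ s t s' t' : ℝ) :
    ouOp θ s t (fun u => ouOp θ s' t' fun v => -h u v)
      = -ouOp θ s t (fun u => ouOp θ s' t' (h u)) := by
  simp only [ouOp_neg]

theorem abs_ouOp_ouOp_le {θ s t s' t' M : ℝ} {h : ℝ → ℝ → ℝ} (hθ : 0 < θ) (hst : s ≤ t)
    (hst' : s' ≤ t') (hh : Continuous fun p : ℝ × ℝ => h p.1 p.2)
    (H : ∀ u ∈ Set.Icc s t, ∀ v ∈ Set.Icc s' t', |h u v| ≤ M) :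
    |ouOp θ s t (fun u => ouOp θ s' t' (h u))| ≤ 4 * M := by
  have := abs_ouOp_le hθ hst (continuous_ouOp hh θ s' t') fun u hu =>
    abs_ouOp_le hθ hst' (hh.comp (by fun_prop : Continuous fun v : ℝ => (u, v))) (H u hu)
  linarith

/-! ### Monotonicity of increments of powers -/

theorem hasDerivAt_rpow_add_sub_rpow {a q x : ℝ} (hq : 0 ≤ q) (hx : 0 < x) :
    HasDerivAt (fun x : ℝ => (x + q) ^ a - x ^ a) (a * (x + q) ^ (a - 1) - a * x ^ (a - 1)) x := by
  have h1 := ((hasDerivAt_id x).add_const q).rpow_const (p := a) (Or.inl (by simp; linarith))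
  have h2 := Real.hasDerivAt_rpow_const (x := x) (p := a) (Or.inl hx.ne')
  exact (h1.sub h2).congr_deriv (by simp)

theorem continuous_rpow_add_sub_rpow {a : ℝ} (ha : 0 ≤ a) (q : ℝ) :
    Continuous fun x : ℝ => (x + q) ^ a - x ^ a :=
  ((continuous_id.add continuous_const).rpow_const fun _ => Or.inr ha).sub
    (continuous_id.rpow_const fun _ => Or.inr ha)

theorem antitoneOn_rpow_add_sub_rpow {a q : ℝ} (ha : 0 ≤ a) (ha1 : a ≤ 1) (hq : 0 ≤ q) :
    AntitoneOn (fun x : ℝ => (x + q) ^ a - x ^ a) (Set.Ici 0) := by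
  refine antitoneOn_of_deriv_nonpos (convex_Ici 0) (continuous_rpow_add_sub_rpow ha q).continuousOn
    ?_ ?_ <;> rw [interior_Ici] <;> intro x (hx : 0 < x)
  · exact (hasDerivAt_rpow_add_sub_rpow hq hx).differentiableAt.differentiableWithinAt
  · rw [(hasDerivAt_rpow_add_sub_rpow hq hx).deriv, ← mul_sub]
    refine mul_nonpos_of_nonneg_of_nonpos ha (sub_nonpos.2 ?_)
    exact Real.rpow_le_rpow_of_nonpos hx (by linarith) (by linarith)

theorem monotoneOn_rpow_add_sub_rpow {a q : ℝ} (ha1 : 1 ≤ a) (hq : 0 ≤ q) :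
    MonotoneOn (fun x : ℝ => (x + q) ^ a - x ^ a) (Set.Ici 0) := by
  refine monotoneOn_of_deriv_nonneg (convex_Ici 0)
    (continuous_rpow_add_sub_rpow (by linarith) q).continuousOn
    ?_ ?_ <;> rw [interior_Ici] <;> intro x (hx : 0 < x)
  · exact (hasDerivAt_rpow_add_sub_rpow hq hx).differentiableAt.differentiableWithinAt
  · rw [(hasDerivAt_rpow_add_sub_rpow hq hx).deriv, ← mul_sub]
    refine mul_nonneg (by linarith) (sub_nonneg.2 ?_)
    exact Real.rpow_le_rpow hx.le (by linarith) (by linarith)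

/-- Homogeneity reduces this to (1 + y)^a ≤ 1 + y. It and the lower bound after it have constants
free of a, so later estimates are uniform in K. -/
theorem add_rpow_le_rpow_add_mul {a q x : ℝ} (ha : a ≤ 1) (hq : 0 ≤ q) (hx : 0 < x) :
    (x + q) ^ a ≤ x ^ a + q * x ^ (a - 1) := by
  have h : x + q = x * (1 + q / x) := by field_simp
  have hy : 0 ≤ q / x := by positivity
  rw [h, Real.mul_rpow hx.le (by linarith), Real.rpow_sub_one hx.ne']
  have : (1 + q / x) ^ a ≤ 1 + q / x := by
    simpa using Real.rpow_le_rpow_of_exponent_le (by linarith : 1 ≤ 1 + q / x) ha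
  calc x ^ a * (1 + q / x) ^ a ≤ x ^ a * (1 + q / x) :=
        mul_le_mul_of_nonneg_left this (by positivity)
    _ = _ := by ring

theorem rpow_sub_mul_le_add_rpow {a q x : ℝ} (ha : -1 ≤ a) (hq : 0 ≤ q) (hx : 0 < x) :
    x ^ a - q * x ^ (a - 1) ≤ (x + q) ^ a := by
  have h : x + q = x * (1 + q / x) := by field_simp
  have hy : 0 ≤ q / x := by positivity
  rw [h, Real.mul_rpow hx.le (by linarith), Real.rpow_sub_one hx.ne']
  have : (1 + q / x) ^ (-1 : ℝ) ≤ (1 + q / x) ^ a :=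
    Real.rpow_le_rpow_of_exponent_le (by linarith : 1 ≤ 1 + q / x) ha
  have h2 : 1 - q / x ≤ (1 + q / x) ^ (-1 : ℝ) := by
    rw [Real.rpow_neg_one, inv_eq_one_div, le_div_iff₀ (by linarith)]
    nlinarith
  calc _ = x ^ a * (1 - q / x) := by ring
    _ ≤ _ := mul_le_mul_of_nonneg_left (h2.trans this) (by positivity)

/-- Subtracting the linear term encodes an upper bound 2qδ^{a-2} for the slope at distance at least
δ from the singularity; the 2 absorbs a ≤ 2. -/
theorem antitoneOn_rpow_add_sub_rpow_sub {a q δ : ℝ} (ha : 1 ≤ a) (ha2 : a ≤ 2) (hq : 0 ≤ q)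
    (hδ : 0 < δ) :
    AntitoneOn (fun x : ℝ => ((x + q) ^ a - x ^ a) - 2 * q * δ ^ (a - 2) * x) (Set.Ici δ) := by
  have hd : ∀ x : ℝ, 0 < x → HasDerivAt
      (fun x : ℝ => ((x + q) ^ a - x ^ a) - 2 * q * δ ^ (a - 2) * x)
      ((a * (x + q) ^ (a - 1) - a * x ^ (a - 1)) - 2 * q * δ ^ (a - 2)) x := fun x hx =>
    ((hasDerivAt_rpow_add_sub_rpow (a := a) hq hx).sub
      ((hasDerivAt_id x).const_mul (2 * q * δ ^ (a - 2)))).congr_deriv (by simp)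
  refine antitoneOn_of_deriv_nonpos (convex_Ici δ)
    ((continuous_rpow_add_sub_rpow (by linarith) q).sub (by fun_prop)).continuousOn
    ?_ ?_ <;> rw [interior_Ici] <;> intro x (hx : δ < x) <;> have hx0 := hδ.trans hx
  · exact (hd x hx0).differentiableAt.differentiableWithinAt
  · rw [(hd x hx0).deriv]
    have h1 := add_rpow_le_rpow_add_mul (a := a - 1) (by linarith) hq hx0
    have h2 : x ^ (a - 2) ≤ δ ^ (a - 2) := Real.rpow_le_rpow_of_nonpos hδ hx.le (by linarith)
    rw [show a - 1 - 1 = a - 2 by ring] at h1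
    have h3 : a * ((x + q) ^ (a - 1) - x ^ (a - 1)) ≤ a * (q * δ ^ (a - 2)) := by
      refine mul_le_mul_of_nonneg_left ?_ (by linarith)
      have := mul_le_mul_of_nonneg_left h2 hq
      linarith
    have h4 : a * (q * δ ^ (a - 2)) ≤ 2 * (q * δ ^ (a - 2)) :=
      mul_le_mul_of_nonneg_right ha2 (by positivity)
    linarith

theorem monotoneOn_rpow_add_sub_rpow_add {a q δ : ℝ} (ha : 0 ≤ a) (ha1 : a ≤ 1) (hq : 0 ≤ q)
    (hδ : 0 < δ) :
    MonotoneOn (fun x : ℝ => ((x + q) ^ a - x ^ a) + q * δ ^ (a - 2) * x) (Set.Ici δ) := by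
  have hd : ∀ x : ℝ, 0 < x → HasDerivAt
      (fun x : ℝ => ((x + q) ^ a - x ^ a) + q * δ ^ (a - 2) * x)
      ((a * (x + q) ^ (a - 1) - a * x ^ (a - 1)) + q * δ ^ (a - 2)) x := fun x hx =>
    ((hasDerivAt_rpow_add_sub_rpow (a := a) hq hx).add
      ((hasDerivAt_id x).const_mul (q * δ ^ (a - 2)))).congr_deriv (by simp)
  refine monotoneOn_of_deriv_nonneg (convex_Ici δ)
    ((continuous_rpow_add_sub_rpow ha q).add (by fun_prop)).continuousOn
    ?_ ?_ <;> rw [interior_Ici] <;> intro x (hx : δ < x) <;> have hx0 := hδ.trans hx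
  · exact (hd x hx0).differentiableAt.differentiableWithinAt
  · rw [(hd x hx0).deriv]
    have h1 := rpow_sub_mul_le_add_rpow (a := a - 1) (by linarith) hq hx0
    have h2 : x ^ (a - 2) ≤ δ ^ (a - 2) := Real.rpow_le_rpow_of_nonpos hδ hx.le (by linarith)
    rw [show a - 1 - 1 = a - 2 by ring] at h1
    have h3 : a * (x ^ (a - 1) - (x + q) ^ (a - 1)) ≤ a * (q * δ ^ (a - 2)) := by
      refine mul_le_mul_of_nonneg_left ?_ (by linarith)
      have := mul_le_mul_of_nonneg_left h2 hq
      linarith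
    have h4 : a * (q * δ ^ (a - 2)) ≤ 1 * (q * δ ^ (a - 2)) :=
      mul_le_mul_of_nonneg_right ha1 (by positivity)
    linarith

/-! ### Rectangle increments of the two covariance kernels -/

theorem continuous_abs_sub_rpow {a : ℝ} (ha : 0 ≤ a) :
    Continuous fun p : ℝ × ℝ => |p.1 - p.2| ^ a :=
  Continuous.rpow_const (by fun_prop) fun _ => Or.inr ha

theorem continuous_rpow_add_rpow_rpow {b K : ℝ} (hb : 0 ≤ b) (hK : 0 ≤ K) :
    Continuous fun p : ℝ × ℝ => (p.1 ^ b + p.2 ^ b) ^ K :=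
  Continuous.rpow_const ((Continuous.rpow_const (by fun_prop) fun _ => Or.inr hb).add
    (Continuous.rpow_const (by fun_prop) fun _ => Or.inr hb)) fun _ => Or.inr hK

/-- The kernel `(u ^ b + v ^ b) ^ K` has nonpositive increments over rectangles. -/
theorem rpow_add_rpow_rpow_increment_nonpos {b K u₁ u₂ v₁ v₂ : ℝ} (hb : 0 ≤ b) (hK : 0 ≤ K)
    (hK1 : K ≤ 1) (hu₁ : 0 ≤ u₁) (hu : u₁ ≤ u₂) (hv₁ : 0 ≤ v₁) (hv : v₁ ≤ v₂) :
    ((u₂ ^ b + v₂ ^ b) ^ K - (u₁ ^ b + v₂ ^ b) ^ K)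
      - ((u₂ ^ b + v₁ ^ b) ^ K - (u₁ ^ b + v₁ ^ b) ^ K) ≤ 0 := by
  have hq : 0 ≤ v₂ ^ b - v₁ ^ b := sub_nonneg.2 (Real.rpow_le_rpow hv₁ hv hb)
  have hp : u₁ ^ b ≤ u₂ ^ b := Real.rpow_le_rpow hu₁ hu hb
  have h0 : 0 ≤ u₁ ^ b := Real.rpow_nonneg hu₁ b
  have h1 : 0 ≤ v₁ ^ b := Real.rpow_nonneg hv₁ b
  have := (antitoneOn_rpow_add_sub_rpow hK hK1 hq) (a := u₁ ^ b + v₁ ^ b) (b := u₂ ^ b + v₁ ^ b)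
    (by simp only [Set.mem_Ici]; positivity) (by simp only [Set.mem_Ici]; linarith) (by linarith)
  simp only [show ∀ x : ℝ, x + v₁ ^ b + (v₂ ^ b - v₁ ^ b) = x + v₂ ^ b by intro x; ring] at this
  linarith

theorem rpow_sub_rpow_le_mul {b m u₁ u₂ : ℝ} (hb : 0 ≤ b) (hb2 : b ≤ 2) (hm : 0 < m)
    (hu₁ : m ≤ u₁) (hu : u₁ ≤ u₂) (hu₂ : u₂ ≤ 2 * m) :
    u₂ ^ b - u₁ ^ b ≤ 4 * m ^ (b - 1) * (u₂ - u₁) := by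
  have hd : ∀ x ∈ Set.Icc m (2 * m), HasDerivAt (fun x : ℝ => x ^ b) (b * x ^ (b - 1)) x :=
    fun x hx => Real.hasDerivAt_rpow_const (Or.inl (hm.trans_le hx.1).ne')
  refine (convex_Icc m (2 * m)).image_sub_le_mul_sub_of_deriv_le
    (fun x hx => (hd x hx).continuousAt.continuousWithinAt)
    (fun x hx => (hd x (interior_subset hx)).differentiableAt.differentiableWithinAt)
    (fun x hx => ?_) u₁ ⟨hu₁, hu.trans hu₂⟩ u₂ ⟨hu₁.trans hu, hu₂⟩ hu
  have hx := interior_subset hx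
  rw [(hd x hx).deriv]
  have hm' : 0 < m ^ (b - 1) := Real.rpow_pos_of_pos hm _
  -- On [m, 2m] the power x^{b-1} varies by at most a factor 2; with b ≤ 2 this gives the constant
  -- 4.
  have : x ^ (b - 1) ≤ 2 * m ^ (b - 1) := by
    rcases le_total b 1 with h | h
    · have := Real.rpow_le_rpow_of_nonpos hm hx.1 (by linarith : b - 1 ≤ 0)
      linarith
    · calc x ^ (b - 1) ≤ (2 * m) ^ (b - 1) :=
            Real.rpow_le_rpow (hm.le.trans hx.1) hx.2 (by linarith)
        _ = 2 ^ (b - 1) * m ^ (b - 1) := Real.mul_rpow (by norm_num) hm.le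
        _ ≤ 2 ^ (1 : ℝ) * m ^ (b - 1) := by
            gcongr
            · norm_num
            · linarith
        _ = _ := by rw [Real.rpow_one]
  have hx' : 0 ≤ x ^ (b - 1) := Real.rpow_nonneg (hm.le.trans hx.1) _
  nlinarith

/-- In the variables p = u^b, q = v^b the increment of -(p + q)^K is at most (m^b)^{K-2} Δp Δq, and
Δp, Δq are at most 4m^{b-1} times Δu, Δv. The exponents add to bK - 2. -/
theorem neg_rpow_add_rpow_rpow_increment_le {b K m u₁ u₂ v₁ v₂ : ℝ} (hb : 0 ≤ b) (hb2 : b ≤ 2)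
    (hK : 0 ≤ K) (hK1 : K ≤ 1) (hm : 0 < m) (hu₁ : m ≤ u₁) (hu : u₁ ≤ u₂) (hu₂ : u₂ ≤ 2 * m)
    (hv₁ : m ≤ v₁) (hv : v₁ ≤ v₂) (hv₂ : v₂ ≤ 2 * m) :
    (-(u₂ ^ b + v₂ ^ b) ^ K - -(u₁ ^ b + v₂ ^ b) ^ K)
      - (-(u₂ ^ b + v₁ ^ b) ^ K - -(u₁ ^ b + v₁ ^ b) ^ K)
      ≤ 16 * m ^ (b * K - 2) * (u₂ - u₁) * (v₂ - v₁) := by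
  have hq : 0 ≤ v₂ ^ b - v₁ ^ b := sub_nonneg.2 (Real.rpow_le_rpow (hm.le.trans hv₁) hv hb)
  have hp : u₁ ^ b ≤ u₂ ^ b := Real.rpow_le_rpow (hm.le.trans hu₁) hu hb
  have h0 : m ^ b ≤ u₁ ^ b := Real.rpow_le_rpow hm.le hu₁ hb
  have h1 : 0 ≤ v₁ ^ b := Real.rpow_nonneg (hm.le.trans hv₁) b
  have h2 : 0 < m ^ b := Real.rpow_pos_of_pos hm b
  have := (monotoneOn_rpow_add_sub_rpow_add hK hK1 hq h2) (a := u₁ ^ b + v₁ ^ b)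
    (b := u₂ ^ b + v₁ ^ b)
    (by simp only [Set.mem_Ici]; linarith) (by simp only [Set.mem_Ici]; linarith) (by linarith)
  simp only [show ∀ x : ℝ, x + v₁ ^ b + (v₂ ^ b - v₁ ^ b) = x + v₂ ^ b by intro x; ring] at this
  have h3 := rpow_sub_rpow_le_mul hb hb2 hm hu₁ hu hu₂
  have h4 := rpow_sub_rpow_le_mul hb hb2 hm hv₁ hv hv₂
  have h5 : (u₂ ^ b - u₁ ^ b) * (v₂ ^ b - v₁ ^ b)
      ≤ (4 * m ^ (b - 1) * (u₂ - u₁)) * (4 * m ^ (b - 1) * (v₂ - v₁)) :=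
    mul_le_mul h3 h4 hq ((sub_nonneg.2 hp).trans h3)
  have h6 : (m ^ b) ^ (K - 2) * (m ^ (b - 1) * m ^ (b - 1)) = m ^ (b * K - 2) := by
    rw [← Real.rpow_mul hm.le, ← Real.rpow_add hm, ← Real.rpow_add hm]
    congr 1; ring
  have h7 := mul_le_mul_of_nonneg_left h5 (Real.rpow_nonneg h2.le (K - 2))
  rw [← h6]
  linarith

theorem neg_abs_sub_rpow_increment_nonpos {a u₁ u₂ v₁ v₂ : ℝ} (ha : 0 ≤ a) (ha1 : a ≤ 1)
    (hvu : v₂ ≤ u₁) (hu : u₁ ≤ u₂) (hv : v₁ ≤ v₂) :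
    (-|u₂ - v₂| ^ a - -|u₁ - v₂| ^ a) - (-|u₂ - v₁| ^ a - -|u₁ - v₁| ^ a) ≤ 0 := by
  rw [abs_of_nonneg (by linarith), abs_of_nonneg (by linarith), abs_of_nonneg (by linarith),
    abs_of_nonneg (by linarith)]
  have := (antitoneOn_rpow_add_sub_rpow ha ha1 (sub_nonneg.2 hv)) (a := u₁ - v₂) (b := u₂ - v₂)
    (by simp only [Set.mem_Ici]; linarith) (by simp only [Set.mem_Ici]; linarith) (by linarith)
  simp only [sub_add_sub_cancel] at this
  linarith

theorem neg_abs_sub_rpow_increment_nonneg {a u₁ u₂ v₁ v₂ : ℝ} (ha1 : 1 ≤ a)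
    (hvu : v₂ ≤ u₁) (hu : u₁ ≤ u₂) (hv : v₁ ≤ v₂) :
    0 ≤ (-|u₂ - v₂| ^ a - -|u₁ - v₂| ^ a) - (-|u₂ - v₁| ^ a - -|u₁ - v₁| ^ a) := by
  rw [abs_of_nonneg (by linarith), abs_of_nonneg (by linarith), abs_of_nonneg (by linarith),
    abs_of_nonneg (by linarith)]
  have := (monotoneOn_rpow_add_sub_rpow ha1 (sub_nonneg.2 hv)) (a := u₁ - v₂) (b := u₂ - v₂)
    (by simp only [Set.mem_Ici]; linarith) (by simp only [Set.mem_Ici]; linarith) (by linarith)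
  simp only [sub_add_sub_cancel] at this
  linarith

theorem neg_abs_sub_rpow_increment_le {a δ u₁ u₂ v₁ v₂ : ℝ} (ha1 : 1 ≤ a) (ha2 : a ≤ 2)
    (hδ : 0 < δ) (hvu : v₂ + δ ≤ u₁) (hu : u₁ ≤ u₂) (hv : v₁ ≤ v₂) :
    (-|u₂ - v₂| ^ a - -|u₁ - v₂| ^ a) - (-|u₂ - v₁| ^ a - -|u₁ - v₁| ^ a)
      ≤ 2 * δ ^ (a - 2) * (u₂ - u₁) * (v₂ - v₁) := by
  rw [abs_of_nonneg (by linarith), abs_of_nonneg (by linarith), abs_of_nonneg (by linarith),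
    abs_of_nonneg (by linarith)]
  have := (antitoneOn_rpow_add_sub_rpow_sub ha1 ha2 (sub_nonneg.2 hv) hδ) (a := u₁ - v₂)
    (b := u₂ - v₂)
    (by simp only [Set.mem_Ici]; linarith) (by simp only [Set.mem_Ici]; linarith) (by linarith)
  simp only [sub_add_sub_cancel] at this
  linarith

/-- Along a strip of width `m - s`, the increments of `|u - v| ^ a` in `v` are Lipschitz. -/
theorem neg_abs_sub_rpow_strip_increment_le {a s m v₁ v₂ : ℝ} (ha1 : 1 ≤ a) (ha2 : a ≤ 2)
    (hsm : s ≤ m) (hv : v₁ ≤ v₂) (hv₂ : v₂ ≤ s) :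
    (-|m - v₂| ^ a - -|s - v₂| ^ a) - (-|m - v₁| ^ a - -|s - v₁| ^ a)
      ≤ 2 * (m - s) ^ (a - 1) * (v₂ - v₁) := by
  rw [abs_of_nonneg (by linarith), abs_of_nonneg (by linarith), abs_of_nonneg (by linarith),
    abs_of_nonneg (by linarith)]
  have hc := continuous_rpow_add_sub_rpow (a := a) (by linarith) (m - s)
  have := (convex_Ici (0 : ℝ)).image_sub_le_mul_sub_of_deriv_le
    (f := fun x : ℝ => (x + (m - s)) ^ a - x ^ a) (C := 2 * (m - s) ^ (a - 1))
    hc.continuousOn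
    (fun x hx => by
      rw [interior_Ici] at hx
      exact (hasDerivAt_rpow_add_sub_rpow (sub_nonneg.2 hsm)
        hx).differentiableAt.differentiableWithinAt)
    (fun x hx => by
      rw [interior_Ici] at hx
      rw [(hasDerivAt_rpow_add_sub_rpow (sub_nonneg.2 hsm) hx).deriv, ← mul_sub]
      -- Subadditivity of x^{a-1}, as 0 ≤ a - 1 ≤ 1; the bound stays finite up to the diagonal.
      have h1 := Real.rpow_add_le_add_rpow (p := a - 1) (le_of_lt hx) (sub_nonneg.2 hsm)
        (by linarith) (by linarith)
      have h2 : 0 ≤ (m - s) ^ (a - 1) := Real.rpow_nonneg (sub_nonneg.2 hsm) _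
      calc _ ≤ a * (m - s) ^ (a - 1) := mul_le_mul_of_nonneg_left (by linarith) (by linarith)
        _ ≤ _ := mul_le_mul_of_nonneg_right ha2 h2)
    (s - v₂) (by simp only [Set.mem_Ici]; linarith) (s - v₁)
    (by simp only [Set.mem_Ici]; linarith) (by linarith)
  simp only [show ∀ v : ℝ, s - v + (m - s) = m - v by intro v; ring] at this
  linarith

/-! ### Closed form of the stationary part on the diagonal -/

theorem continuous_rpow_const_of_nonneg {a : ℝ} (ha : 0 ≤ a) : Continuous fun u : ℝ => u ^ a :=
  continuous_id.rpow_const fun _ => Or.inr ha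

/-- Integration by parts. This and the next identity evaluate the halves v < u and v > u of the
double integral of |u - v|^a; their values agree. -/
theorem two_mul_integral_exp_mul_lower_gamma {a : ℝ} (ha : 0 ≤ a) (θ t : ℝ) :
    2 * θ * ∫ u in (0 : ℝ)..t, Real.exp (-2 * θ * (t - u)) *
        ∫ z in (0 : ℝ)..u, Real.exp (-θ * z) * z ^ a
      = (∫ z in (0 : ℝ)..t, Real.exp (-θ * z) * z ^ a)
        - Real.exp (-θ * t) * ∫ u in (0 : ℝ)..t, Real.exp (-θ * (t - u)) * u ^ a := by
  have hr := continuous_rpow_const_of_nonneg ha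
  have hc : Continuous fun z : ℝ => Real.exp (-θ * z) * z ^ a := by fun_prop
  have hI : ∀ u, HasDerivAt (fun u => ∫ z in (0 : ℝ)..u, Real.exp (-θ * z) * z ^ a)
      (Real.exp (-θ * u) * u ^ a) u := fun u => hc.integral_hasStrictDerivAt 0 u |>.hasDerivAt
  have hIc : Continuous fun u => ∫ z in (0 : ℝ)..u, Real.exp (-θ * z) * z ^ a :=
    continuous_iff_continuousAt.2 fun u => (hI u).continuousAt
  have h := intervalIntegral.integral_eq_sub_of_hasDerivAt (a := 0) (b := t)
    (f := fun u => Real.exp (-2 * θ * (t - u)) * ∫ z in (0 : ℝ)..u, Real.exp (-θ * z) * z ^ a)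
    (f' := fun u => 2 * θ * (Real.exp (-2 * θ * (t - u)) *
        ∫ z in (0 : ℝ)..u, Real.exp (-θ * z) * z ^ a)
      + Real.exp (-θ * t) * (Real.exp (-θ * (t - u)) * u ^ a))
    (fun u _ => by
      refine ((((hasDerivAt_id' u).const_sub t).const_mul (-2 * θ)).exp.mul (hI u)).congr_deriv ?_
      have : Real.exp (-2 * θ * (t - u)) * Real.exp (-θ * u)
          = Real.exp (-θ * t) * Real.exp (-θ * (t - u)) := by
        rw [← Real.exp_add, ← Real.exp_add]; congr 1; ring
      rw [← mul_assoc (Real.exp (-2 * θ * (t - u))) (Real.exp (-θ * u)), this]; ring)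
    (Continuous.intervalIntegrable (by fun_prop) _ _)
  rw [intervalIntegral.integral_add (Continuous.intervalIntegrable (by fun_prop) _ _)
    (Continuous.intervalIntegrable (by fun_prop) _ _), intervalIntegral.integral_const_mul,
    intervalIntegral.integral_const_mul] at h
  simp only [sub_self, mul_zero, Real.exp_zero, one_mul, intervalIntegral.integral_same,
    sub_zero] at h
  linarith

theorem two_mul_integral_exp_mul_convolution {a : ℝ} (ha : 0 ≤ a) (θ t : ℝ) :
    2 * θ * ∫ x in (0 : ℝ)..t, Real.exp (-θ * x) *
        ∫ u in (0 : ℝ)..x, Real.exp (-θ * (x - u)) * u ^ a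
      = (∫ z in (0 : ℝ)..t, Real.exp (-θ * z) * z ^ a)
        - Real.exp (-θ * t) * ∫ u in (0 : ℝ)..t, Real.exp (-θ * (t - u)) * u ^ a := by
  have hr := continuous_rpow_const_of_nonneg ha
  have hc : Continuous fun z : ℝ => Real.exp (θ * z) * z ^ a := by fun_prop
  have hW : ∀ u, HasDerivAt (fun u => ∫ z in (0 : ℝ)..u, Real.exp (θ * z) * z ^ a)
      (Real.exp (θ * u) * u ^ a) u := fun u => hc.integral_hasStrictDerivAt 0 u |>.hasDerivAt
  have hWc : Continuous fun u => ∫ z in (0 : ℝ)..u, Real.exp (θ * z) * z ^ a :=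
    continuous_iff_continuousAt.2 fun u => (hW u).continuousAt
  have hJ : ∀ x : ℝ, Real.exp (-θ * x) * ∫ u in (0 : ℝ)..x, Real.exp (-θ * (x - u)) * u ^ a
      = Real.exp (-2 * θ * x) * ∫ z in (0 : ℝ)..x, Real.exp (θ * z) * z ^ a := by
    intro x
    rw [← intervalIntegral.integral_const_mul, ← intervalIntegral.integral_const_mul]
    congr 1; ext u
    rw [← mul_assoc, ← mul_assoc, ← Real.exp_add, ← Real.exp_add]
    congr 2; ring
  simp only [hJ]
  have h := intervalIntegral.integral_eq_sub_of_hasDerivAt (a := 0) (b := t)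
    (f := fun x => Real.exp (-2 * θ * x) * ∫ z in (0 : ℝ)..x, Real.exp (θ * z) * z ^ a)
    (f' := fun x => Real.exp (-θ * x) * x ^ a - 2 * θ * (Real.exp (-2 * θ * x) *
        ∫ z in (0 : ℝ)..x, Real.exp (θ * z) * z ^ a))
    (fun u _ => by
      refine (((hasDerivAt_id' u).const_mul (-2 * θ)).exp.mul (hW u)).congr_deriv ?_
      have : Real.exp (-2 * θ * u) * Real.exp (θ * u) = Real.exp (-θ * u) := by
        rw [← Real.exp_add]; congr 1; ring
      rw [← mul_assoc (Real.exp (-2 * θ * u)) (Real.exp (θ * u)), this]; ring)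
    (Continuous.intervalIntegrable (by fun_prop) _ _)
  rw [intervalIntegral.integral_sub (Continuous.intervalIntegrable (by fun_prop) _ _)
    (Continuous.intervalIntegrable (by fun_prop) _ _), intervalIntegral.integral_const_mul] at h
  simp only [intervalIntegral.integral_same, mul_zero, sub_zero] at h
  linarith

theorem integral_exp_mul_sub_rpow (a θ t : ℝ) :
    ∫ u in (0 : ℝ)..t, Real.exp (-θ * (t - u)) * (t - u) ^ a
      = ∫ z in (0 : ℝ)..t, Real.exp (-θ * z) * z ^ a := by
  rw [intervalIntegral.integral_comp_sub_left (fun z => Real.exp (-θ * z) * z ^ a) t]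
  simp

theorem integral_exp_mul_abs_sub_rpow {a θ t u : ℝ} (ha : 0 ≤ a) (hu : 0 ≤ u) (hut : u ≤ t) :
    ∫ v in (0 : ℝ)..t, Real.exp (-θ * (t - v)) * |u - v| ^ a
      = Real.exp (-θ * (t - u)) * (∫ z in (0 : ℝ)..u, Real.exp (-θ * z) * z ^ a)
        + ∫ z in (0 : ℝ)..(t - u), Real.exp (-θ * (t - u - z)) * z ^ a := by
  have hF : Continuous fun v : ℝ => |u - v| ^ a :=
    Continuous.rpow_const (by fun_prop) fun _ => Or.inr ha
  rw [← intervalIntegral.integral_add_adjacent_intervals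
    (intervalIntegrable_exp_mul hF θ t 0 u) (intervalIntegrable_exp_mul hF θ t u t)]
  congr 1
  · rw [← integral_exp_mul_sub_rpow, ← intervalIntegral.integral_const_mul]
    refine intervalIntegral.integral_congr fun v hv => ?_
    rw [Set.uIcc_of_le hu] at hv
    rw [abs_of_nonneg (by linarith [hv.2]), ← mul_assoc, ← Real.exp_add]
    congr 2; ring
  · have := intervalIntegral.integral_comp_sub_right
      (fun z => Real.exp (-θ * (t - u - z)) * z ^ a) u (a := u) (b := t)
    rw [sub_self] at this
    rw [← this]
    refine intervalIntegral.integral_congr fun v hv => ?_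
    rw [Set.uIcc_of_le hut] at hv
    rw [abs_sub_comm, abs_of_nonneg (by linarith [hv.1])]
    congr 3; ring

/-- The inner integral is cut at v = u, and u is replaced by t - u in the second half. Each half is
1/(2θ) times the right-hand side. -/
theorem mul_integral_integral_exp_mul_abs_sub_rpow {a θ t : ℝ} (ha : 0 ≤ a)
    (ht : 0 ≤ t) :
    θ * ∫ u in (0 : ℝ)..t, Real.exp (-θ * (t - u)) *
        ∫ v in (0 : ℝ)..t, Real.exp (-θ * (t - v)) * |u - v| ^ a
      = (∫ z in (0 : ℝ)..t, Real.exp (-θ * z) * z ^ a)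
        - Real.exp (-θ * t) * ∫ u in (0 : ℝ)..t, Real.exp (-θ * (t - u)) * u ^ a := by
  have hr := continuous_rpow_const_of_nonneg ha
  have hI : Continuous fun u => ∫ z in (0 : ℝ)..u, Real.exp (-θ * z) * z ^ a :=
    intervalIntegral.continuous_primitive
      (fun _ _ => Continuous.intervalIntegrable (by fun_prop) _ _) 0
  have hJ : Continuous fun x => ∫ z in (0 : ℝ)..x, Real.exp (-θ * (x - z)) * z ^ a := by
    have h : Continuous fun x => Real.exp (-θ * x) * ∫ z in (0 : ℝ)..x, Real.exp (θ * z) * z ^ a :=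
      (by fun_prop : Continuous fun x => Real.exp (-θ * x)).mul
        (intervalIntegral.continuous_primitive
          (fun _ _ => Continuous.intervalIntegrable (by fun_prop) _ _) 0)
    convert h using 2 with x
    rw [← intervalIntegral.integral_const_mul]
    congr 1; ext u
    rw [← mul_assoc, ← Real.exp_add]
    congr 2; ring
  have hJt : Continuous fun u => ∫ z in (0 : ℝ)..(t - u), Real.exp (-θ * (t - u - z)) * z ^ a :=
    hJ.comp (by fun_prop : Continuous fun u => t - u)
  have h1 : ∫ u in (0 : ℝ)..t, Real.exp (-θ * (t - u)) *
        ∫ v in (0 : ℝ)..t, Real.exp (-θ * (t - v)) * |u - v| ^ a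
      = ∫ u in (0 : ℝ)..t, (Real.exp (-2 * θ * (t - u)) *
          (∫ z in (0 : ℝ)..u, Real.exp (-θ * z) * z ^ a)
        + Real.exp (-θ * (t - u)) *
          ∫ z in (0 : ℝ)..(t - u), Real.exp (-θ * (t - u - z)) * z ^ a) := by
    refine intervalIntegral.integral_congr fun u hu => ?_
    rw [Set.uIcc_of_le ht] at hu
    rw [integral_exp_mul_abs_sub_rpow ha hu.1 hu.2, mul_add, ← mul_assoc, ← Real.exp_add]
    congr 3; ring
  have h2 := intervalIntegral.integral_comp_sub_left (a := 0) (b := t)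
    (fun x => Real.exp (-θ * x) * ∫ z in (0 : ℝ)..x, Real.exp (-θ * (x - z)) * z ^ a) t
  rw [sub_self, sub_zero] at h2
  rw [h1, intervalIntegral.integral_add (Continuous.intervalIntegrable (by fun_prop) _ _)
    (Continuous.intervalIntegrable (by fun_prop) _ _), h2]
  have h3 := two_mul_integral_exp_mul_lower_gamma ha θ t
  have h4 := two_mul_integral_exp_mul_convolution ha θ t
  linarith

/-- The stationary part of the variance in closed form. -/
theorem ouOp_ouOp_neg_abs_sub_rpow {a θ t : ℝ} (ha : 0 < a) (ht : 0 ≤ t) :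
    ouOp θ 0 t (fun u => ouOp θ 0 t fun v => -|u - v| ^ a)
      = θ * (∫ z in (0 : ℝ)..t, Real.exp (-θ * z) * z ^ a)
        + Real.exp (-θ * t) *
          (2 * t ^ a - θ * ∫ u in (0 : ℝ)..t, Real.exp (-θ * (t - u)) * u ^ a) := by
  have hr := continuous_rpow_const_of_nonneg ha.le
  have hF : Continuous fun p : ℝ × ℝ => |p.1 - p.2| ^ a := continuous_abs_sub_rpow ha.le
  have hD := mul_integral_integral_exp_mul_abs_sub_rpow (θ := θ) ha.le ht
  set I := ∫ z in (0 : ℝ)..t, Real.exp (-θ * z) * z ^ a with hI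
  set J := ∫ u in (0 : ℝ)..t, Real.exp (-θ * (t - u)) * u ^ a with hJ
  have hin : ∀ u ∈ Set.Icc 0 t, ouOp θ 0 t (fun v => |u - v| ^ a)
      = (t - u) ^ a - Real.exp (-θ * t) * u ^ a
        - θ * ∫ v in (0 : ℝ)..t, Real.exp (-θ * (t - v)) * |u - v| ^ a := by
    intro u hu
    unfold ouOp
    beta_reduce
    rw [abs_sub_comm, abs_of_nonneg (by linarith [hu.2]), sub_zero, sub_zero, abs_of_nonneg hu.1]
  have hcd : Continuous fun u =>
      ∫ v in (0 : ℝ)..t, Real.exp (-θ * (t - v)) * |u - v| ^ a := by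
    apply intervalIntegral.continuous_parametric_intervalIntegral_of_continuous'
    unfold Function.uncurry
    fun_prop
  have hcs : Continuous fun u : ℝ => (t - u) ^ a := hr.comp (by fun_prop)
  simp only [ouOp_neg]
  rw [ouOp_congr ht hin]
  have h0 : ∫ v in (0 : ℝ)..t, Real.exp (-θ * (t - v)) * |0 - v| ^ a = J := by
    refine intervalIntegral.integral_congr fun v hv => ?_
    rw [Set.uIcc_of_le ht] at hv
    simp only [zero_sub, abs_neg, abs_of_nonneg hv.1]
  have h1 : ∫ v in (0 : ℝ)..t, Real.exp (-θ * (t - v)) * |t - v| ^ a = I := by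
    rw [hI, ← integral_exp_mul_sub_rpow]
    refine intervalIntegral.integral_congr fun v hv => ?_
    rw [Set.uIcc_of_le ht] at hv
    simp only [abs_of_nonneg (sub_nonneg.2 hv.2)]
  -- The right-hand side is zero: the double integral cancels the single ones, so only boundary
  -- terms survive.
  have h2 : ∫ u in (0 : ℝ)..t, Real.exp (-θ * (t - u)) *
      ((t - u) ^ a - Real.exp (-θ * t) * u ^ a
        - θ * ∫ v in (0 : ℝ)..t, Real.exp (-θ * (t - v)) * |u - v| ^ a)
      = I - Real.exp (-θ * t) * J - (I - Real.exp (-θ * t) * J) := by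
    simp only [show ∀ e x y z : ℝ, e * (x - Real.exp (-θ * t) * y - θ * z)
      = e * x - Real.exp (-θ * t) * (e * y) - θ * (e * z) by intros; ring]
    rw [intervalIntegral.integral_sub (Continuous.intervalIntegrable (by fun_prop) _ _)
      (Continuous.intervalIntegrable (by fun_prop) _ _),
      intervalIntegral.integral_sub (Continuous.intervalIntegrable (by fun_prop) _ _)
      (Continuous.intervalIntegrable (by fun_prop) _ _), intervalIntegral.integral_const_mul,
      intervalIntegral.integral_const_mul, integral_exp_mul_sub_rpow, hD]
  unfold ouOp
  beta_reduce
  rw [h0, h1, h2, Real.zero_rpow ha.ne', sub_self, Real.zero_rpow ha.ne', sub_zero]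
  ring

/-! ### Estimates for the stationary part -/

theorem pow_mul_exp_neg_le {c x : ℝ} (hc : 0 < c) (hx : 0 ≤ x) (n : ℕ) :
    x ^ n * Real.exp (-c * x) ≤ n.factorial / c ^ n := by
  have h := Real.pow_div_factorial_le_exp (c * x) (mul_nonneg hc.le hx) n
  rw [neg_mul, Real.exp_neg, ← div_eq_mul_inv, div_le_div_iff₀ (Real.exp_pos _) (by positivity)]
  rw [div_le_iff₀ (by positivity), mul_pow] at h
  linarith

theorem rpow_le_one_add_sq {a x : ℝ} (ha : 0 ≤ a) (ha2 : a ≤ 2) (hx : 0 ≤ x) :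
    x ^ a ≤ 1 + x ^ 2 := by
  rcases le_total x 1 with h | h
  · have := Real.rpow_le_one hx h ha
    nlinarith
  · have := Real.rpow_le_rpow_of_exponent_le h ha2
    rw [Real.rpow_two] at this
    linarith

theorem rpow_eq_rpow_sub_two_mul_sq {a x : ℝ} (hx : 0 < x) : x ^ a = x ^ (a - 2) * x ^ 2 := by
  rw [← Real.rpow_two, ← Real.rpow_add hx]; congr 1; ring

/-- Trades exponential decay for two powers of x; every damped term gets its rate this way. -/
theorem exp_neg_mul_rpow_le {a c x : ℝ} (hc : 0 < c) (hx : 0 < x) :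
    Real.exp (-c * x) * x ^ a ≤ 2 / c ^ 2 * x ^ (a - 2) := by
  have h := pow_mul_exp_neg_le hc hx.le 2
  rw [rpow_eq_rpow_sub_two_mul_sq hx]
  have h2 := mul_le_mul_of_nonneg_right h (Real.rpow_nonneg hx.le (a - 2))
  norm_num at h2 ⊢
  linarith

theorem half_rpow_sub_two_le {a x : ℝ} (ha : 0 ≤ a) (hx : 0 < x) :
    (x / 2) ^ (a - 2) ≤ 4 * x ^ (a - 2) := by
  rw [Real.div_rpow hx.le (by norm_num), div_eq_mul_inv, ← Real.rpow_neg (by norm_num), mul_comm]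
  refine mul_le_mul_of_nonneg_right ?_ (Real.rpow_nonneg hx.le _)
  calc (2 : ℝ) ^ (-(a - 2)) ≤ 2 ^ (2 : ℝ) :=
        Real.rpow_le_rpow_of_exponent_le (by norm_num) (by linarith)
    _ = 4 := by norm_num

theorem integral_exp_neg_mul_rpow_le {a θ t : ℝ} (hθ : 0 < θ) (ha : 0 ≤ a) (ha2 : a ≤ 2)
    (ht : 0 ≤ t) :
    θ * ∫ z in (0 : ℝ)..t, Real.exp (-θ * z) * z ^ a ≤ 2 * (1 + 8 / θ ^ 2) := by
  have hr := continuous_rpow_const_of_nonneg ha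
  have hcs : Continuous fun u : ℝ => (t - u) ^ a := hr.comp (by fun_prop)
  rw [← integral_exp_mul_sub_rpow]
  have h1 : ∫ u in (0 : ℝ)..t, Real.exp (-θ * (t - u)) * (t - u) ^ a
      ≤ ∫ u in (0 : ℝ)..t, (1 + 8 / θ ^ 2) * Real.exp (-(θ / 2) * (t - u)) := by
    refine intervalIntegral.integral_mono_on ht (Continuous.intervalIntegrable (by fun_prop) _ _)
      (Continuous.intervalIntegrable (by fun_prop) _ _) fun u hu => ?_
    have hz : 0 ≤ t - u := sub_nonneg.2 hu.2
    have h2 := rpow_le_one_add_sq ha ha2 hz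
    have h3 := pow_mul_exp_neg_le (half_pos hθ) hz 2
    have h4 : Real.exp (-(θ / 2) * (t - u)) ≤ 1 := exp_neg_mul_sub_le_one (half_pos hθ) hu.2
    -- Half of the exponential bounds the power, the other half is integrated.
    have h5 : Real.exp (-θ * (t - u))
        = Real.exp (-(θ / 2) * (t - u)) * Real.exp (-(θ / 2) * (t - u)) := by
      rw [← Real.exp_add]; congr 1; ring
    have h6 : ((2 : ℕ).factorial : ℝ) / (θ / 2) ^ 2 = 8 / θ ^ 2 := by
      norm_num [div_pow]; field_simp; norm_num
    rw [h6] at h3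
    have h7 : Real.exp (-(θ / 2) * (t - u)) * (t - u) ^ a ≤ 1 + 8 / θ ^ 2 := by
      have := mul_le_mul_of_nonneg_left h2 (Real.exp_pos (-(θ / 2) * (t - u))).le
      linarith
    rw [h5]
    have := mul_le_mul_of_nonneg_left h7 (Real.exp_pos (-(θ / 2) * (t - u))).le
    linarith
  rw [intervalIntegral.integral_const_mul] at h1
  have h2 := integral_exp_mul_sub (θ / 2) 0 t
  have h3 := Real.exp_pos (-(θ / 2) * (t - 0))
  have h4 := mul_le_mul_of_nonneg_left h1 hθ.le
  have h5 : 0 ≤ 1 + 8 / θ ^ 2 := by positivity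
  have h6 : (1 + 8 / θ ^ 2) * (θ / 2 * ∫ u in (0 : ℝ)..t, Real.exp (-(θ / 2) * (t - u)))
      ≤ (1 + 8 / θ ^ 2) * 1 := mul_le_mul_of_nonneg_left (by linarith) h5
  linarith

theorem mul_integral_exp_mul_rpow_mem {a θ t : ℝ} (hθ : 0 < θ) (ha : 0 ≤ a) (ht : 0 ≤ t) :
    0 ≤ θ * (∫ u in (0 : ℝ)..t, Real.exp (-θ * (t - u)) * u ^ a) ∧
      θ * (∫ u in (0 : ℝ)..t, Real.exp (-θ * (t - u)) * u ^ a) ≤ t ^ a := by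
  have hr := continuous_rpow_const_of_nonneg ha
  have h1 := integral_exp_mul_le hθ ht hr (M := t ^ a) fun u hu =>
    Real.rpow_le_rpow hu.1 hu.2 ha
  have h2 := le_integral_exp_mul hθ ht hr (M := 0) fun u hu => Real.rpow_nonneg hu.1 a
  have h3 : 0 ≤ Real.exp (-θ * (t - 0)) * t ^ a :=
    mul_nonneg (Real.exp_pos _).le (Real.rpow_nonneg ht a)
  constructor <;> linarith

theorem ouOp_ouOp_neg_abs_sub_rpow_le {a θ t : ℝ} (hθ : 0 < θ) (ha : 0 < a) (ha2 : a ≤ 2)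
    (ht : 0 ≤ t) :
    ouOp θ 0 t (fun u => ouOp θ 0 t fun v => -|u - v| ^ a) ≤ 4 * (1 + 8 / θ ^ 2) := by
  rw [ouOp_ouOp_neg_abs_sub_rpow ha ht]
  have h1 := integral_exp_neg_mul_rpow_le hθ ha.le ha2 ht
  obtain ⟨h2, -⟩ := mul_integral_exp_mul_rpow_mem hθ ha.le ht
  have h3 := pow_mul_exp_neg_le hθ ht 2
  have h4 : Real.exp (-θ * t) ≤ 1 := by simpa using exp_neg_mul_sub_le_one (s := 0) hθ ht
  have h5 := rpow_le_one_add_sq ha.le ha2 ht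
  have h6 := (Real.exp_pos (-θ * t)).le
  have h7 := mul_nonneg h6 h2
  have h8 := mul_le_mul_of_nonneg_left h5 h6
  have h9 : ((2 : ℕ).factorial : ℝ) / θ ^ 2 ≤ 8 / θ ^ 2 := by
    gcongr; norm_num
  norm_num at h3 h9
  simp only [← neg_mul] at h3
  linarith

/-- In the closed form, completing the integral to (0, ∞) gives θΓ(a+1)/θ^{a+1}. The tail costs
16/θ², and the boundary term, which lies between 0 and 2e^{-θt}t^a, costs 4/θ². -/
theorem abs_ouOp_ouOp_neg_abs_sub_rpow_sub_le {a θ t : ℝ} (hθ : 0 < θ) (ha : 0 < a) (ha2 : a ≤ 2)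
    (ht : 0 < t) :
    |ouOp θ 0 t (fun u => ouOp θ 0 t fun v => -|u - v| ^ a) - a * Real.Gamma a / θ ^ a|
      ≤ 20 / θ ^ 2 * t ^ (a - 2) := by
  rw [ouOp_ouOp_neg_abs_sub_rpow ha ht.le]
  obtain ⟨h1, h2⟩ := mul_integral_exp_mul_rpow_mem hθ ha.le ht.le
  have hint : IntegrableOn (fun z : ℝ => Real.exp (-θ * z) * z ^ a) (Set.Ioi 0) := by
    have := integrableOn_rpow_mul_exp_neg_mul_rpow (p := 1) (s := a) (b := θ) (by linarith)
      one_pos hθ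
    simpa only [Real.rpow_one, mul_comm] using this
  have hG : θ * ∫ z in Set.Ioi (0 : ℝ), Real.exp (-θ * z) * z ^ a
      = a * Real.Gamma a / θ ^ a := by
    have := Real.integral_rpow_mul_exp_neg_mul_Ioi (a := a + 1) (r := θ) (by linarith) hθ
    simp only [add_sub_cancel_right, ← neg_mul] at this
    simp only [mul_comm (Real.exp _)]
    rw [this, Real.Gamma_add_one ha.ne', Real.rpow_add_one (by positivity),
      Real.div_rpow zero_le_one hθ.le, Real.one_rpow]
    field_simp
  have hsplit : ∫ z in Set.Ioi (0 : ℝ), Real.exp (-θ * z) * z ^ a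
      = (∫ z in (0 : ℝ)..t, Real.exp (-θ * z) * z ^ a)
        + ∫ z in Set.Ioi t, Real.exp (-θ * z) * z ^ a := by
    rw [intervalIntegral.integral_of_le ht.le, ← setIntegral_union Set.Ioc_disjoint_Ioi_same
      measurableSet_Ioi (hint.mono_set Set.Ioc_subset_Ioi_self)
      (hint.mono_set (Set.Ioi_subset_Ioi ht.le)), Set.Ioc_union_Ioi_eq_Ioi ht.le]
  have htail0 : 0 ≤ ∫ z in Set.Ioi t, Real.exp (-θ * z) * z ^ a :=
    setIntegral_nonneg measurableSet_Ioi fun z hz =>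
      mul_nonneg (Real.exp_pos _).le (Real.rpow_nonneg (ht.trans hz).le a)
  have hexp : IntegrableOn (fun z : ℝ => Real.exp (-(θ / 2) * z)) (Set.Ioi t) :=
    integrableOn_exp_mul_Ioi (by linarith) t
  have htail : ∫ z in Set.Ioi t, Real.exp (-θ * z) * z ^ a
      ≤ ∫ z in Set.Ioi t, (8 / θ ^ 2 * t ^ (a - 2)) * Real.exp (-(θ / 2) * z) := by
    refine setIntegral_mono_on (hint.mono_set (Set.Ioi_subset_Ioi ht.le)) (hexp.const_mul _)
      measurableSet_Ioi fun z hz => ?_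
    have hz0 : 0 < z := ht.trans hz
    have h3 := exp_neg_mul_rpow_le (a := a) (half_pos hθ) hz0
    have h4 : z ^ (a - 2) ≤ t ^ (a - 2) :=
      Real.rpow_le_rpow_of_nonpos ht (le_of_lt hz) (by linarith)
    have h5 : Real.exp (-θ * z) = Real.exp (-(θ / 2) * z) * Real.exp (-(θ / 2) * z) := by
      rw [← Real.exp_add]; congr 1; ring
    have h6 : 2 / (θ / 2) ^ 2 = 8 / θ ^ 2 := by field_simp; norm_num
    rw [h6] at h3
    have h7 : Real.exp (-(θ / 2) * z) * z ^ a ≤ 8 / θ ^ 2 * t ^ (a - 2) :=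
      h3.trans (mul_le_mul_of_nonneg_left h4 (by positivity))
    rw [h5]
    have := mul_le_mul_of_nonneg_left h7 (Real.exp_pos (-(θ / 2) * z)).le
    linarith
  rw [integral_const_mul, integral_exp_mul_Ioi (by linarith)] at htail
  have h8 : Real.exp (-(θ / 2) * t) ≤ 1 := by
    simpa using exp_neg_mul_sub_le_one (s := 0) (half_pos hθ) ht.le
  have hp : 0 ≤ t ^ (a - 2) := Real.rpow_nonneg ht.le _
  have h9 : θ * ∫ z in Set.Ioi t, Real.exp (-θ * z) * z ^ a ≤ 16 / θ ^ 2 * t ^ (a - 2) := by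
    calc _ ≤ θ * (8 / θ ^ 2 * t ^ (a - 2) * (-Real.exp (-(θ / 2) * t) / -(θ / 2))) :=
          mul_le_mul_of_nonneg_left htail hθ.le
      _ = 16 / θ ^ 2 * t ^ (a - 2) * Real.exp (-(θ / 2) * t) := by field_simp; norm_num
      _ ≤ 16 / θ ^ 2 * t ^ (a - 2) * 1 := mul_le_mul_of_nonneg_left h8 (by positivity)
      _ = _ := mul_one _
  have h10 := exp_neg_mul_rpow_le (a := a) hθ ht
  have h11 := (Real.exp_pos (-θ * t)).le
  have h12 := mul_le_mul_of_nonneg_left h2 h11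
  have h13 := mul_nonneg h11 h1
  have h14 := mul_nonneg hθ.le htail0
  have h15 : 0 ≤ Real.exp (-θ * t) * t ^ a := h13.trans h12
  have h16 : 20 / θ ^ 2 * t ^ (a - 2)
      = 16 / θ ^ 2 * t ^ (a - 2) + 2 * (2 / θ ^ 2 * t ^ (a - 2)) := by ring
  rw [← hG, hsplit, h16, abs_le]
  constructor <;> nlinarith

theorem ouOp_ouOp_neg_abs_sub_rpow_le_rpow {a θ s t : ℝ} (hθ : 0 < θ) (ha : 0 < a) (ha2 : a ≤ 2)
    (hs : 0 ≤ s) (hst : s < t) (hr : 1 ≤ t - s) :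
    ouOp θ 0 t (fun u => ouOp θ 0 s fun v => -|u - v| ^ a)
      ≤ (8 * (1 + 8 / θ ^ 2) / θ ^ 2 + 16 / θ ^ 2) * (t - s) ^ (a - 2) := by
  have hF : Continuous fun p : ℝ × ℝ => -|p.1 - p.2| ^ a := (continuous_abs_sub_rpow ha.le).neg
  have hFu : ∀ u : ℝ, Continuous fun v : ℝ => -|u - v| ^ a := fun u =>
    hF.comp (by fun_prop : Continuous fun v : ℝ => (u, v))
  have hL : ∀ p q, Continuous fun u => ouOp θ p q fun v => -|u - v| ^ a := continuous_ouOp hF θ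
  have hr0 : 0 < t - s := by linarith
  have hp : 0 ≤ (t - s) ^ (a - 2) := Real.rpow_nonneg hr0.le _
  rw [ouOp_split (hL 0 s) θ 0 s t]
  have h1 : Real.exp (-θ * (t - s)) * ouOp θ 0 s (fun u => ouOp θ 0 s fun v => -|u - v| ^ a)
      ≤ 8 * (1 + 8 / θ ^ 2) / θ ^ 2 * (t - s) ^ (a - 2) := by
    -- Here t - s ≥ 1 is used: inserting (t-s)^a ≥ 1 turns the exponential into (t-s)^{a-2}.
    have h2 := exp_neg_mul_rpow_le (a := a) hθ hr0
    have h3 : 1 ≤ (t - s) ^ a := Real.one_le_rpow hr ha.le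
    have h4 : Real.exp (-θ * (t - s)) ≤ 2 / θ ^ 2 * (t - s) ^ (a - 2) :=
      (le_mul_of_one_le_right (Real.exp_pos _).le h3).trans h2
    calc _ ≤ Real.exp (-θ * (t - s)) * (4 * (1 + 8 / θ ^ 2)) :=
          mul_le_mul_of_nonneg_left (ouOp_ouOp_neg_abs_sub_rpow_le hθ ha ha2 hs) (Real.exp_pos _).le
      _ ≤ (2 / θ ^ 2 * (t - s) ^ (a - 2)) * (4 * (1 + 8 / θ ^ 2)) :=
          mul_le_mul_of_nonneg_right h4 (by positivity)
      _ = _ := by ring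
  suffices h : ouOp θ s t (fun u => ouOp θ 0 s fun v => -|u - v| ^ a)
      ≤ 16 / θ ^ 2 * (t - s) ^ (a - 2) by linarith
  rcases le_total a 1 with ha1 | ha1
  · have h2 := ouOp_ouOp_le (M := 0) (h := fun u v => -|u - v| ^ a) hθ hst.le hs le_rfl hF
      fun u₁ hu₁ u₂ hu₂ hu v₁ hv₁ v₂ hv₂ hv => by
      simpa only [zero_mul] using
        neg_abs_sub_rpow_increment_nonpos ha.le ha1 (hv₂.2.trans hu₁.1) hu hv
    rw [zero_div] at h2
    exact h2.trans (by positivity)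
  -- For a ≥ 1 the mixed derivative is nonnegative and may blow up at the diagonal, so the strip s ≤
  -- u ≤ s + δ is treated apart.
  · set δ := (t - s) / 2 with hδ
    have hδ0 : 0 < δ := by positivity
    have hm : s + δ ≤ t := by linarith
    rw [ouOp_split (hL 0 s) θ s (s + δ) t]
    have h2 : ouOp θ (s + δ) t (fun u => ouOp θ 0 s fun v => -|u - v| ^ a)
        ≤ 2 * δ ^ (a - 2) / θ ^ 2 :=
      ouOp_ouOp_le hθ hm hs (by positivity) hF fun u₁ hu₁ u₂ hu₂ hu v₁ hv₁ v₂ hv₂ hv =>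
        neg_abs_sub_rpow_increment_le ha1 ha2 hδ0 (by linarith [hv₂.2, hu₁.1]) hu hv
    have h3 : ouOp θ s (s + δ) (fun u => ouOp θ 0 s fun v => -|u - v| ^ a)
        ≤ 2 * δ ^ (a - 1) / θ := by
      -- The inner integral is monotone in u, so the strip contributes at most its total increment.
      -- The resulting δ^{a-1} has one power too many, which e^{-θδ} removes below.
      refine (ouOp_le_sub hθ (by linarith) (hL 0 s) fun u₁ hu₁ u₂ hu₂ hu => ?_).trans ?_
      · rw [← sub_nonneg, ← ouOp_sub (hFu _) (hFu _)]
        refine ouOp_nonneg hθ hs ((hFu _).sub (hFu _)) fun v₁ hv₁ v₂ hv₂ hv => ?_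
        exact sub_nonneg.1 (neg_abs_sub_rpow_increment_nonneg ha1 (hv₂.2.trans hu₁.1) hu hv)
      · rw [← ouOp_sub (hFu _) (hFu _)]
        refine ouOp_le_of_sub_le hθ hs (by positivity) ((hFu _).sub (hFu _))
          fun v₁ hv₁ v₂ hv₂ hv => ?_
        simpa using neg_abs_sub_rpow_strip_increment_le ha1 ha2 (m := s + δ) (by linarith) hv hv₂.2
    have h4 := pow_mul_exp_neg_le hθ hδ0.le 1
    have h5 : δ ^ (a - 1) = δ ^ (a - 2) * δ := by
      rw [← Real.rpow_add_one hδ0.ne']; congr 1; ring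
    have h6 : Real.exp (-θ * (t - (s + δ))) *
        ouOp θ s (s + δ) (fun u => ouOp θ 0 s fun v => -|u - v| ^ a) ≤ 2 * δ ^ (a - 2) / θ ^ 2 := by
      rw [show t - (s + δ) = δ by linarith]
      calc _ ≤ Real.exp (-θ * δ) * (2 * δ ^ (a - 1) / θ) :=
            mul_le_mul_of_nonneg_left h3 (Real.exp_pos _).le
        _ = 2 * δ ^ (a - 2) / θ * (δ ^ 1 * Real.exp (-θ * δ)) := by rw [h5]; ring
        _ ≤ 2 * δ ^ (a - 2) / θ * ((1 : ℕ).factorial / θ ^ 1) :=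
            mul_le_mul_of_nonneg_left h4 (by positivity)
        _ = _ := by simp; field_simp
    have h7 : δ ^ (a - 2) ≤ 4 * (t - s) ^ (a - 2) := half_rpow_sub_two_le ha.le hr0
    have h8 : 4 / θ ^ 2 * δ ^ (a - 2) ≤ 4 / θ ^ 2 * (4 * (t - s) ^ (a - 2)) :=
      mul_le_mul_of_nonneg_left h7 (by positivity)
    have h9 : 4 / θ ^ 2 * δ ^ (a - 2) = 2 * δ ^ (a - 2) / θ ^ 2 + 2 * δ ^ (a - 2) / θ ^ 2 := by ring
    have h10 : 4 / θ ^ 2 * (4 * (t - s) ^ (a - 2)) = 16 / θ ^ 2 * (t - s) ^ (a - 2) := by ring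
    linarith

/-! ### Estimates for the nonstationary part -/

theorem ouOp_ouOp_rpow_add_rpow_rpow_nonpos {b K θ s t : ℝ} (hθ : 0 < θ) (hb : 0 ≤ b)
    (hK : 0 ≤ K) (hK1 : K ≤ 1) (hs : 0 ≤ s) (ht : 0 ≤ t) :
    ouOp θ 0 t (fun u => ouOp θ 0 s fun v => (u ^ b + v ^ b) ^ K) ≤ 0 := by
  have h := ouOp_ouOp_le (M := 0) hθ ht hs le_rfl (continuous_rpow_add_rpow_rpow hb hK)
    fun u₁ hu₁ u₂ hu₂ hu v₁ hv₁ v₂ hv₂ hv => by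
      simpa using rpow_add_rpow_rpow_increment_nonpos hb hK hK1 hu₁.1 hu hv₁.1 hv
  simpa using h

/-- Cutting both variables at t/2 leaves [t/2, t]², where the increment bound applies, and two
pieces with a factor e^{-θt/2}, where a sup bound is enough. The constant is 192 = 2·8·8 + 16·4. -/
theorem neg_le_ouOp_ouOp_rpow_add_rpow_rpow {b K θ t : ℝ} (hθ : 0 < θ) (hb : 0 ≤ b) (hb2 : b ≤ 2)
    (hK : 0 ≤ K) (hK1 : K ≤ 1) (ht : 0 < t) :
    -(192 / θ ^ 2 * t ^ (b * K - 2))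
      ≤ ouOp θ 0 t (fun u => ouOp θ 0 t fun v => (u ^ b + v ^ b) ^ K) := by
  have hA : Continuous fun p : ℝ × ℝ => -(p.1 ^ b + p.2 ^ b) ^ K :=
    (continuous_rpow_add_rpow_rpow hb hK).neg
  rw [neg_le, ← ouOp_ouOp_neg]
  set m := t / 2 with hm
  have hm0 : 0 < m := by positivity
  have hmt : m ≤ t := by linarith
  have hbd : ∀ u ∈ Set.Icc 0 t, ∀ v ∈ Set.Icc 0 t, |-(u ^ b + v ^ b) ^ K| ≤ 2 * t ^ (b * K) := by
    intro u hu v hv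
    have h1 := Real.rpow_nonneg hu.1 b
    have h2 := Real.rpow_nonneg hv.1 b
    have h3 := Real.rpow_le_rpow hu.1 hu.2 hb
    have h4 := Real.rpow_le_rpow hv.1 hv.2 hb
    rw [abs_neg, abs_of_nonneg (Real.rpow_nonneg (by linarith) _)]
    calc (u ^ b + v ^ b) ^ K ≤ (2 * t ^ b) ^ K := Real.rpow_le_rpow (by linarith) (by linarith) hK
      _ = 2 ^ K * t ^ (b * K) := by
          rw [Real.mul_rpow (by norm_num) (by positivity), Real.rpow_mul ht.le]
      _ ≤ 2 ^ (1 : ℝ) * t ^ (b * K) := by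
          refine mul_le_mul_of_nonneg_right ?_ (by positivity)
          exact Real.rpow_le_rpow_of_exponent_le (by norm_num) hK1
      _ = _ := by rw [Real.rpow_one]
  rw [ouOp_split (continuous_ouOp hA θ 0 t) θ 0 m t, ouOp_ouOp_split hA θ m t 0 m t]
  have h1 := (le_abs_self _).trans <| abs_ouOp_ouOp_le hθ hm0.le ht.le hA fun u hu v hv =>
    hbd u ⟨hu.1, hu.2.trans hmt⟩ v hv
  have h2 := (le_abs_self _).trans <| abs_ouOp_ouOp_le hθ hmt hm0.le hA fun u hu v hv =>
    hbd u ⟨hm0.le.trans hu.1, hu.2⟩ v ⟨hv.1, hv.2.trans hmt⟩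
  have h3 := ouOp_ouOp_le (M := 16 * m ^ (b * K - 2)) hθ hmt hmt (by positivity) hA
    fun u₁ hu₁ u₂ hu₂ hu v₁ hv₁ v₂ hv₂ hv =>
      neg_rpow_add_rpow_rpow_increment_le hb hb2 hK hK1 hm0 hu₁.1 hu (by linarith [hu₂.2]) hv₁.1 hv
        (by linarith [hv₂.2])
  rw [show t - m = m by linarith]
  have he := (Real.exp_pos (-θ * m)).le
  have h4 := mul_le_mul_of_nonneg_left h1 he
  have h5 := mul_le_mul_of_nonneg_left h2 he
  have h6 : Real.exp (-θ * m) * t ^ (b * K) ≤ 8 / θ ^ 2 * t ^ (b * K - 2) := by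
    have := exp_neg_mul_rpow_le (a := b * K) (half_pos hθ) ht
    rw [show -(θ / 2) * t = -θ * m by rw [hm]; ring,
      show 2 / (θ / 2) ^ 2 = 8 / θ ^ 2 by field_simp; norm_num] at this
    exact this
  have h7 : m ^ (b * K - 2) ≤ 4 * t ^ (b * K - 2) := half_rpow_sub_two_le (mul_nonneg hb hK) ht
  have h8 : 16 * m ^ (b * K - 2) / θ ^ 2 ≤ 64 / θ ^ 2 * t ^ (b * K - 2) := by
    calc _ = 16 / θ ^ 2 * m ^ (b * K - 2) := by ring
      _ ≤ 16 / θ ^ 2 * (4 * t ^ (b * K - 2)) := mul_le_mul_of_nonneg_left h7 (by positivity)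
      _ = _ := by ring
  have h9 : 192 / θ ^ 2 * t ^ (b * K - 2)
      = 16 * (8 / θ ^ 2 * t ^ (b * K - 2)) + 64 / θ ^ 2 * t ^ (b * K - 2) := by ring
  linarith

/-! ### Pathwise solution of the Langevin equation -/

/-- The primitive Y of x solves the ordinary equation Y' = -θY + g, so the integrating factor gives
Y(t) = ∫ e^{-θ(t-u)} g(u) du even for rough g; then x = -θY + g. -/
theorem langevin_eq_ouOp {θ : ℝ} {x g : ℝ≥0 → ℝ} (hx : Continuous x) (hg : Continuous g)
    (hx0 : x 0 = 0)
    (h : ∀ t : ℝ≥0, x t = -θ * (∫ s in (0 : ℝ)..(t : ℝ), x s.toNNReal) + g t) (t : ℝ≥0) :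
    x t = ouOp θ 0 t fun u => g u.toNNReal := by
  have hxc : Continuous fun s : ℝ => x s.toNNReal := hx.comp continuous_real_toNNReal
  have hgc : Continuous fun s : ℝ => g s.toNNReal := hg.comp continuous_real_toNNReal
  have hg0 : g 0 = 0 := by
    have := h 0
    simpa [hx0] using this.symm
  have hI : ∀ u, HasDerivAt (fun u => ∫ s in (0 : ℝ)..u, x s.toNNReal) (x u.toNNReal) u :=
    fun u => hxc.integral_hasStrictDerivAt 0 u |>.hasDerivAt
  have hF := intervalIntegral.integral_eq_sub_of_hasDerivAt (a := 0) (b := t)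
    (f := fun u => Real.exp (-θ * (t - u)) * ∫ s in (0 : ℝ)..u, x s.toNNReal)
    (f' := fun u => Real.exp (-θ * (t - u)) * g u.toNNReal)
    (fun u hu => by
      rw [Set.uIcc_of_le t.coe_nonneg] at hu
      refine ((((hasDerivAt_id' u).const_sub (t : ℝ)).const_mul (-θ)).exp.mul (hI u)).congr_deriv ?_
      have := h u.toNNReal
      rw [Real.coe_toNNReal u hu.1] at this
      rw [this]; ring)
    (intervalIntegrable_exp_mul hgc _ _ _ _)
  unfold ouOp
  rw [hF, h t]
  simp [hg0]
  ring

/-! ### Joint measurability, square integrability and Fubini -/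

theorem sq_integral_le {f : ℝ → ℝ} (hf : Continuous f) {t : ℝ} (ht : 0 ≤ t) :
    (∫ u in (0 : ℝ)..t, f u) ^ 2 ≤ t * ∫ u in (0 : ℝ)..t, f u ^ 2 := by
  set c := ∫ u in (0 : ℝ)..t, f u with hc
  have h : 0 ≤ ∫ u in (0 : ℝ)..t, (t * f u - c) ^ 2 :=
    intervalIntegral.integral_nonneg ht fun u _ => sq_nonneg _
  have h1 : ∫ u in (0 : ℝ)..t, (t * f u - c) ^ 2
      = t ^ 2 * (∫ u in (0 : ℝ)..t, f u ^ 2) - 2 * t * c * c + c ^ 2 * t := by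
    simp only [show ∀ u, (t * f u - c) ^ 2 = t ^ 2 * f u ^ 2 - 2 * t * c * f u + c ^ 2 by
      intro u; ring]
    rw [intervalIntegral.integral_add (Continuous.intervalIntegrable (by fun_prop) _ _)
      (Continuous.intervalIntegrable (by fun_prop) _ _),
      intervalIntegral.integral_sub (Continuous.intervalIntegrable (by fun_prop) _ _)
      (Continuous.intervalIntegrable (by fun_prop) _ _), intervalIntegral.integral_const_mul,
      intervalIntegral.integral_const_mul, intervalIntegral.integral_const, ← hc]
    simp; ring
  rcases ht.eq_or_lt with rfl | ht
  · simp [hc]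
  · rw [h1] at h
    have : 0 ≤ t * (t * (∫ u in (0 : ℝ)..t, f u ^ 2) - c ^ 2) := by linarith
    have := nonneg_of_mul_nonneg_right this ht
    linarith

section ContinuousPaths

variable {Ω : Type*} [MeasurableSpace Ω] {P : Measure Ω} {B : ℝ≥0 → Ω → ℝ}

/-- A process with almost surely continuous paths is jointly measurable up to a null set. -/
theorem aestronglyMeasurable_process [SFinite P] (hB : ∀ t, AEMeasurable (B t) P)
    (hc : ∀ᵐ ω ∂P, Continuous fun t => B t ω) (μ : Measure ℝ) [SFinite μ] :
    AEStronglyMeasurable (fun p : ℝ × Ω => B p.1.toNNReal p.2) (μ.prod P) := by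
  -- Time is discretized to ⌊un⌋/n. Only countably many sections occur, so one null set serves for
  -- all their measurable versions, and path continuity gives the limit.
  set q : ℕ → ℕ → ℝ≥0 := fun n k => (k : ℝ≥0) / n with hq
  set k : ℕ → ℝ → ℕ := fun n u => ⌊(u.toNNReal : ℝ) * n⌋₊ with hk
  have hlim : ∀ u : ℝ, Filter.Tendsto (fun n => q n (k n u)) Filter.atTop (nhds u.toNNReal) := by
    intro u
    rw [← NNReal.tendsto_coe]
    have := (tendsto_nat_floor_mul_div_atTop (R := ℝ) u.toNNReal.2).comp
      tendsto_natCast_atTop_atTop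
    simpa [hq, hk, Function.comp_def] using this
  have hmk : ∀ᵐ ω ∂P, ∀ n j, (hB (q n j)).mk _ ω = B (q n j) ω :=
    ae_all_iff.2 fun n => ae_all_iff.2 fun j => (hB (q n j)).ae_eq_mk.symm
  refine aestronglyMeasurable_of_tendsto_ae Filter.atTop
    (f := fun n (p : ℝ × Ω) => (hB (q n (k n p.1))).mk _ p.2) (fun n => ?_) ?_
  · have h1 : Measurable fun p : ℕ × Ω => (hB (q n p.1)).mk _ p.2 :=
      measurable_from_prod_countable_right fun j => (hB (q n j)).measurable_mk
    have h2 : Measurable fun p : ℝ × Ω => (k n p.1, p.2) := by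
      refine Measurable.prodMk ?_ measurable_snd
      exact Nat.measurable_floor.comp (by fun_prop)
    exact (h1.comp h2).aestronglyMeasurable
  · have := Measure.quasiMeasurePreserving_snd (μ := μ) (ν := P) |>.ae (hc.and hmk)
    filter_upwards [this] with p hp
    simp only [hp.2]
    exact (hp.1.tendsto _).comp (hlim p.1)

variable [IsProbabilityMeasure P]

theorem integrable_prod_sq (hB : ∀ t, MemLp (B t) 2 P)
    (hc : ∀ᵐ ω ∂P, Continuous fun t => B t ω)
    (hv : Continuous fun u : ℝ => ∫ ω, B u.toNNReal ω ^ 2 ∂P) (t : ℝ) :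
    Integrable (fun p : ℝ × Ω => B p.1.toNNReal p.2 ^ 2)
      ((volume.restrict (Set.Ioc 0 t)).prod P) := by
  have hm := aestronglyMeasurable_process (fun t => (hB t).1.aemeasurable) hc
    (volume.restrict (Set.Ioc 0 t))
  have hm2 : AEStronglyMeasurable (fun p : ℝ × Ω => B p.1.toNNReal p.2 ^ 2)
      ((volume.restrict (Set.Ioc 0 t)).prod P) := hm.pow 2
  rw [integrable_prod_iff hm2]
  refine ⟨Filter.Eventually.of_forall fun u => (hB u.toNNReal).integrable_sq, ?_⟩
  simp only [norm_pow, Real.norm_eq_abs, sq_abs]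
  exact (hv.integrableOn_Icc (a := 0) (b := t)).mono_set Set.Ioc_subset_Icc_self

theorem integrable_prod_exp_mul_mul {θ : ℝ} (hθ : 0 < θ) (hB : ∀ t, MemLp (B t) 2 P)
    (hc : ∀ᵐ ω ∂P, Continuous fun t => B t ω)
    (hv : Continuous fun u : ℝ => ∫ ω, B u.toNNReal ω ^ 2 ∂P) {Z : Ω → ℝ} (hZ : MemLp Z 2 P)
    (t : ℝ) :
    Integrable (fun p : ℝ × Ω => Real.exp (-θ * (t - p.1)) * B p.1.toNNReal p.2 * Z p.2)
      ((volume.restrict (Set.Ioc 0 t)).prod P) := by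
  have hm := aestronglyMeasurable_process (fun t => (hB t).1.aemeasurable) hc
    (volume.restrict (Set.Ioc 0 t))
  have hZ2 : Integrable (fun p : ℝ × Ω => Z p.2 ^ 2) ((volume.restrict (Set.Ioc 0 t)).prod P) :=
    hZ.integrable_sq.comp_snd _
  have hmem : ∀ᵐ p ∂((volume.restrict (Set.Ioc 0 t)).prod P), p.1 ∈ Set.Ioc 0 t :=
    Measure.quasiMeasurePreserving_fst.ae (ae_restrict_mem measurableSet_Ioc)
  refine ((integrable_prod_sq hB hc hv t).add hZ2).mono' ?_ ?_
  · have he : Measurable fun p : ℝ × Ω => Real.exp (-θ * (t - p.1)) := by fun_prop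
    exact (he.aestronglyMeasurable.mul hm).mul hZ.1.comp_snd
  · filter_upwards [hmem] with p hp
    have h1 := exp_neg_mul_sub_le_one hθ hp.2
    have h2 := Real.exp_pos (-θ * (t - p.1))
    rw [mul_assoc, norm_mul, Real.norm_eq_abs, abs_of_pos h2, Real.norm_eq_abs]
    have h3 : |B p.1.toNNReal p.2 * Z p.2| ≤ B p.1.toNNReal p.2 ^ 2 + Z p.2 ^ 2 := by
      rw [abs_le]
      constructor <;> nlinarith [sq_nonneg (B p.1.toNNReal p.2 + Z p.2),
        sq_nonneg (B p.1.toNNReal p.2 - Z p.2)]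
    exact (mul_le_of_le_one_left (abs_nonneg _) h1).trans h3

theorem memLp_integral_exp_mul {θ : ℝ} (hθ : 0 < θ) (hB : ∀ t, MemLp (B t) 2 P)
    (hc : ∀ᵐ ω ∂P, Continuous fun t => B t ω)
    (hv : Continuous fun u : ℝ => ∫ ω, B u.toNNReal ω ^ 2 ∂P) {t : ℝ} (ht : 0 ≤ t) :
    MemLp (fun ω => ∫ u in (0 : ℝ)..t, Real.exp (-θ * (t - u)) * B u.toNNReal ω) 2 P := by
  have h1 := (integrable_prod_exp_mul_mul hθ hB hc hv (memLp_const (1 : ℝ)) t).integral_prod_right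
  simp only [mul_one] at h1
  have h2 := (integrable_prod_sq hB hc hv t).integral_prod_right
  simp only [intervalIntegral.integral_of_le ht]
  rw [memLp_two_iff_integrable_sq h1.1]
  refine (h2.const_mul t).mono' (h1.1.pow 2) ?_
  filter_upwards [hc] with ω hω
  have hb : Continuous fun u : ℝ => B u.toNNReal ω := hω.comp continuous_real_toNNReal
  rw [Real.norm_eq_abs, abs_of_nonneg (sq_nonneg _)]
  simp only [← intervalIntegral.integral_of_le ht]
  refine (sq_integral_le (by fun_prop) ht).trans (mul_le_mul_of_nonneg_left ?_ ht)
  refine intervalIntegral.integral_mono_on ht (Continuous.intervalIntegrable (by fun_prop) _ _)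
    (Continuous.intervalIntegrable (by fun_prop) _ _) fun u hu => ?_
  rw [mul_pow]
  exact mul_le_of_le_one_left (sq_nonneg _)
    (pow_le_one₀ (Real.exp_pos _).le (exp_neg_mul_sub_le_one hθ hu.2))

theorem memLp_ouOp {θ : ℝ} (hθ : 0 < θ) (hB : ∀ t, MemLp (B t) 2 P)
    (hc : ∀ᵐ ω ∂P, Continuous fun t => B t ω)
    (hv : Continuous fun u : ℝ => ∫ ω, B u.toNNReal ω ^ 2 ∂P) {t : ℝ} (ht : 0 ≤ t) :
    MemLp (fun ω => ouOp θ 0 t fun u => B u.toNNReal ω) 2 P :=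
  ((hB _).sub ((hB _).const_mul _)).sub ((memLp_integral_exp_mul hθ hB hc hv ht).const_mul θ)

/-- Fubini, with |BZ| ≤ B² + Z² as domination. A general square integrable Z allows two uses: first
with Z = X_s, then with Z a value of B. -/
theorem integral_ouOp_mul {θ : ℝ} (hθ : 0 < θ) (hB : ∀ t, MemLp (B t) 2 P)
    (hc : ∀ᵐ ω ∂P, Continuous fun t => B t ω)
    (hv : Continuous fun u : ℝ => ∫ ω, B u.toNNReal ω ^ 2 ∂P) {Z : Ω → ℝ} (hZ : MemLp Z 2 P)
    {t : ℝ} (ht : 0 ≤ t) :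
    ∫ ω, ouOp θ 0 t (fun u => B u.toNNReal ω) * Z ω ∂P
      = ouOp θ 0 t fun u => ∫ ω, B u.toNNReal ω * Z ω ∂P := by
  have hI := (memLp_integral_exp_mul hθ hB hc hv ht).integrable_mul hZ
  have hBZ : ∀ u, Integrable (fun ω => B u ω * Z ω) P := fun u => (hB u).integrable_mul hZ
  have hswap : ∫ ω, (∫ u in (0 : ℝ)..t, Real.exp (-θ * (t - u)) * B u.toNNReal ω) * Z ω ∂P
      = ∫ u in (0 : ℝ)..t, Real.exp (-θ * (t - u)) * ∫ ω, B u.toNNReal ω * Z ω ∂P := by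
    simp only [intervalIntegral.integral_of_le ht, ← integral_const_mul, ← integral_mul_const]
    rw [integral_integral_swap]
    · simp only [mul_assoc]
    · exact (integrable_prod_exp_mul_mul hθ hB hc hv hZ t).swap
  unfold ouOp
  simp only [sub_mul, mul_assoc]
  rw [integral_sub, integral_sub, integral_const_mul, integral_const_mul, hswap]
  · exact hBZ _
  · exact (hBZ _).const_mul _
  · exact (hBZ _).sub ((hBZ _).const_mul _)
  · exact hI.const_mul θ

end ContinuousPaths

/-! ### Covariance of the Ornstein–Uhlenbeck process and the theorem -/

theorem IsBifractionalBrownianMotion.memLp {Ω : Type*} [MeasurableSpace Ω] {P : Measure Ω}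
    {H K : ℝ} {B : ℝ≥0 → Ω → ℝ} (hB : IsBifractionalBrownianMotion H K B P) (t : ℝ≥0) :
    MemLp (B t) 2 P :=
  (hB.isGaussianProcess.hasGaussianLaw_eval t).memLp_two

theorem IsBifractionalBrownianMotion.continuous_integral_sq {Ω : Type*} [MeasurableSpace Ω]
    {P : Measure Ω} {H K : ℝ} (hH : 0 < H) (hK : 0 < K) {B : ℝ≥0 → Ω → ℝ}
    (hB : IsBifractionalBrownianMotion H K B P) :
    Continuous fun u : ℝ => ∫ ω, B u.toNNReal ω ^ 2 ∂P := by
  have hHK : 0 < 2 * H * K := by positivity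
  have hb : Continuous fun x : ℝ => x ^ (2 * H) := continuous_rpow_const_of_nonneg (by positivity)
  have hk : Continuous fun x : ℝ => x ^ K := continuous_rpow_const_of_nonneg hK.le
  simp only [pow_two, hB.integral_mul, sub_self, abs_zero, Real.zero_rpow hHK.ne', sub_zero]
  have := hb.comp (NNReal.continuous_coe.comp continuous_real_toNNReal)
  exact (hk.comp (this.add this)).const_mul _

theorem IsOrnsteinUhlenbeck.ae_eq_ouOp {Ω : Type*} [MeasurableSpace Ω] {P : Measure Ω} {θ : ℝ}
    {B X : ℝ≥0 → Ω → ℝ} (hX : IsOrnsteinUhlenbeck θ B X P)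
    (hc : ∀ᵐ ω ∂P, Continuous fun t : ℝ≥0 => B t ω) (t : ℝ≥0) :
    X t =ᵐ[P] fun ω => ouOp θ 0 t fun u => B u.toNNReal ω := by
  filter_upwards [hX.initial, hX.continuous_paths, hX.integral_equation, hc] with ω h0 h1 h2 h3
  exact langevin_eq_ouOp h1 h3 h0 h2 t

section

variable {Ω : Type*} [MeasurableSpace Ω] {P : Measure Ω} [IsProbabilityMeasure P]
  {θ H K : ℝ} {B X : ℝ≥0 → Ω → ℝ}

theorem IsOrnsteinUhlenbeck.memLp (hθ : 0 < θ) (hH : 0 < H) (hK : 0 < K)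
    (hB : IsBifractionalBrownianMotion H K B P) (hX : IsOrnsteinUhlenbeck θ B X P) (t : ℝ≥0) :
    MemLp (X t) 2 P :=
  (memLp_congr_ae (hX.ae_eq_ouOp hB.continuous_paths t)).2
    (memLp_ouOp hθ hB.memLp hB.continuous_paths (hB.continuous_integral_sq hH hK) t.coe_nonneg)

theorem IsOrnsteinUhlenbeck.integral_mul (hθ : 0 < θ) (hH : 0 < H) (hK : 0 < K)
    (hB : IsBifractionalBrownianMotion H K B P) (hX : IsOrnsteinUhlenbeck θ B X P) (t s : ℝ≥0) :
    ∫ ω, X t ω * X s ω ∂P = 1 / (2 : ℝ) ^ K *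
      (ouOp θ 0 t (fun u => ouOp θ 0 s fun v => (u ^ (2 * H) + v ^ (2 * H)) ^ K)
        + ouOp θ 0 t (fun u => ouOp θ 0 s fun v => -|u - v| ^ (2 * H * K))) := by
  have hv := hB.continuous_integral_sq hH hK
  have hstep : ∀ (r : ℝ≥0) {Z : Ω → ℝ}, MemLp Z 2 P →
      ∫ ω, X r ω * Z ω ∂P = ouOp θ 0 r fun u => ∫ ω, B u.toNNReal ω * Z ω ∂P := by
    intro r Z hZ
    rw [← integral_ouOp_mul hθ hB.memLp hB.continuous_paths hv hZ r.coe_nonneg]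
    refine integral_congr_ae ?_
    filter_upwards [hX.ae_eq_ouOp hB.continuous_paths r] with ω hω
    rw [hω]
  have hA := continuous_rpow_add_rpow_rpow (b := 2 * H) (K := K) (by positivity) hK.le
  have hF : Continuous fun p : ℝ × ℝ => -|p.1 - p.2| ^ (2 * H * K) :=
    (continuous_abs_sub_rpow (by positivity)).neg
  have hAu : ∀ u : ℝ, Continuous fun v : ℝ => (u ^ (2 * H) + v ^ (2 * H)) ^ K := fun u =>
    hA.comp (by fun_prop : Continuous fun v : ℝ => (u, v))
  have hFu : ∀ u : ℝ, Continuous fun v : ℝ => -|u - v| ^ (2 * H * K) := fun u =>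
    hF.comp (by fun_prop : Continuous fun v : ℝ => (u, v))
  rw [hstep t (hX.memLp hθ hH hK hB s),
    ← ouOp_add (continuous_ouOp hA θ 0 s) (continuous_ouOp hF θ 0 s), ← ouOp_const_mul]
  refine ouOp_congr t.coe_nonneg fun u hu0 => ?_
  rw [← ouOp_add (hAu u) (hFu u), ← ouOp_const_mul]
  simp only [mul_comm (B _ _)]
  rw [hstep s (hB.memLp _)]
  refine ouOp_congr s.coe_nonneg fun v hv0 => ?_
  rw [hB.integral_mul, Real.coe_toNNReal u hu0.1, Real.coe_toNNReal v hv0.1, sub_eq_add_neg]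

theorem one_div_two_rpow_mem (hK : 0 ≤ K) : 0 < 1 / (2 : ℝ) ^ K ∧ 1 / (2 : ℝ) ^ K ≤ 1 := by
  have h : (1 : ℝ) ≤ 2 ^ K := Real.one_le_rpow (by norm_num) hK
  exact ⟨by positivity, by rw [div_le_one (by positivity)]; exact h⟩

theorem IsOrnsteinUhlenbeck.abs_integral_sq_sub_le (hθ : 0 < θ) (hH : 0 < H) (hH1 : H ≤ 1)
    (hK : 0 < K) (hK1 : K ≤ 1) (hB : IsBifractionalBrownianMotion H K B P)
    (hX : IsOrnsteinUhlenbeck θ B X P) {t : ℝ≥0} (ht : 0 < t) :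
    |(∫ ω, (X t ω) ^ 2 ∂P)
        - H * K * Real.Gamma (2 * H * K) / ((2 : ℝ) ^ (K - 1) * θ ^ (2 * H * K))|
      ≤ 212 / θ ^ 2 * (t : ℝ) ^ (2 * H * K - 2) := by
  have ha : 0 < 2 * H * K := by positivity
  have ha2 : 2 * H * K ≤ 2 := by nlinarith
  have ht' : (0 : ℝ) < t := ht
  obtain ⟨hc0, hc1⟩ := one_div_two_rpow_mem hK.le
  -- The limit is 2^{-K} · aΓ(a)/θ^a with a = 2HK.
  have hlim : H * K * Real.Gamma (2 * H * K) / ((2 : ℝ) ^ (K - 1) * θ ^ (2 * H * K))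
      = 1 / (2 : ℝ) ^ K * (2 * H * K * Real.Gamma (2 * H * K) / θ ^ (2 * H * K)) := by
    rw [Real.rpow_sub_one (by norm_num)]
    field_simp
  have h1 := abs_ouOp_ouOp_neg_abs_sub_rpow_sub_le hθ ha ha2 ht'
  have h2 := ouOp_ouOp_rpow_add_rpow_rpow_nonpos (b := 2 * H) hθ (by positivity) hK.le hK1
    ht'.le ht'.le
  have h3 := neg_le_ouOp_ouOp_rpow_add_rpow_rpow (b := 2 * H) hθ (by positivity) (by linarith)
    hK.le hK1 ht'
  have h4 : |ouOp θ 0 t (fun u => ouOp θ 0 t fun v => (u ^ (2 * H) + v ^ (2 * H)) ^ K)|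
      ≤ 192 / θ ^ 2 * (t : ℝ) ^ (2 * H * K - 2) := by
    rw [abs_of_nonpos h2]; linarith
  simp only [pow_two (X t _)]
  rw [hX.integral_mul hθ hH hK hB, hlim, ← mul_sub, abs_mul, abs_of_pos hc0, add_sub_assoc]
  calc _ ≤ 1 * _ := mul_le_mul_of_nonneg_right hc1 (abs_nonneg _)
    _ ≤ _ := by
      rw [one_mul]
      refine (abs_add_le _ _).trans ((add_le_add h4 h1).trans (le_of_eq ?_))
      ring

/-- The nonstationary part is nonpositive and is dropped, which is why the bound is one-sided. -/
theorem IsOrnsteinUhlenbeck.integral_mul_le (hθ : 0 < θ) (hH : 0 < H) (hH1 : H ≤ 1)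
    (hK : 0 < K) (hK1 : K ≤ 1) (hB : IsBifractionalBrownianMotion H K B P)
    (hX : IsOrnsteinUhlenbeck θ B X P) {t s : ℝ≥0} (hts : 1 ≤ |(t : ℝ) - s|) :
    ∫ ω, X t ω * X s ω ∂P ≤
      (8 * (1 + 8 / θ ^ 2) / θ ^ 2 + 16 / θ ^ 2) * |(t : ℝ) - s| ^ (2 * H * K - 2) := by
  wlog hst : s ≤ t generalizing s t
  · rw [abs_sub_comm] at hts ⊢
    simpa only [mul_comm (X t _)] using this hts (le_of_not_ge hst)
  have hst' : (s : ℝ) ≤ t := hst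
  rw [abs_of_nonneg (sub_nonneg.2 hst')] at hts ⊢
  have ha : 0 < 2 * H * K := by positivity
  have ha2 : 2 * H * K ≤ 2 := by nlinarith
  obtain ⟨hc0, hc1⟩ := one_div_two_rpow_mem hK.le
  have h1 := ouOp_ouOp_neg_abs_sub_rpow_le_rpow hθ ha ha2 s.coe_nonneg (by linarith) hts
  have h2 := ouOp_ouOp_rpow_add_rpow_rpow_nonpos (b := 2 * H) hθ (by positivity) hK.le hK1
    s.coe_nonneg t.coe_nonneg
  have h3 : 0 ≤ (8 * (1 + 8 / θ ^ 2) / θ ^ 2 + 16 / θ ^ 2) * ((t : ℝ) - s) ^ (2 * H * K - 2) :=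
    mul_nonneg (by positivity) (Real.rpow_nonneg (by linarith) _)
  rw [hX.integral_mul hθ hH hK hB]
  exact (mul_le_mul_of_nonneg_left (by linarith) hc0.le).trans (mul_le_of_le_one_left h3 hc1)

end

theorem theorem4p3 (θ H : ℝ) (hθ : 0 < θ) (hH0 : 0 < H) (hH1 : H < 1) :
    ∃ C : ℝ, 0 < C ∧
      ∀ K : ℝ, 0 < K → K < 1 → H * K ≠ 1 / 2 →
      ∀ (Ω : Type*) [MeasurableSpace Ω] (P : Measure Ω) [IsProbabilityMeasure P]
        (B X : ℝ≥0 → Ω → ℝ),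
        IsBifractionalBrownianMotion H K B P → IsOrnsteinUhlenbeck θ B X P →
        (∀ t : ℝ≥0, MemLp (X t) 2 P) ∧
        (∀ t : ℝ≥0, 2 < t →
          |(∫ ω, (X t ω) ^ 2 ∂P)
              - H * K * Real.Gamma (2 * H * K) / ((2 : ℝ) ^ (K - 1) * θ ^ (2 * H * K))|
            ≤ C * (t : ℝ) ^ (2 * H * K - 2)) ∧
        (∀ t s : ℝ≥0, 2 < |(t : ℝ) - (s : ℝ)| →
          ∫ ω, X t ω * X s ω ∂P
            ≤ C * (if H < 1 / 2 then |(t : ℝ) - (s : ℝ)| ^ (2 * H * K - 2 * H - 1)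
                else |(t : ℝ) - (s : ℝ)| ^ (2 * H * K - 2))) := by
  have hC : (0 : ℝ) ≤ 8 * (1 + 8 / θ ^ 2) / θ ^ 2 + 16 / θ ^ 2 := by positivity
  refine ⟨212 / θ ^ 2 + (8 * (1 + 8 / θ ^ 2) / θ ^ 2 + 16 / θ ^ 2), by positivity, ?_⟩
  intro K hK hK1 _ Ω _ P _ B X hB hX
  refine ⟨hX.memLp hθ hH0 hK hB, fun t ht => ?_, fun t s hts => ?_⟩
  · refine (hX.abs_integral_sq_sub_le hθ hH0 hH1.le hK hK1.le hB (two_pos.trans ht)).trans ?_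
    exact mul_le_mul_of_nonneg_right (by linarith) (Real.rpow_nonneg t.coe_nonneg _)
  · have hr : 1 ≤ |(t : ℝ) - s| := by linarith
    refine (hX.integral_mul_le hθ hH0 hH1.le hK hK1.le hB hr).trans ?_
    refine mul_le_mul ?_ ?_ (Real.rpow_nonneg (abs_nonneg _) _) (by positivity)
    · have : 0 ≤ 212 / θ ^ 2 := by positivity
      linarith
    · split_ifs with h
      -- For H < 1/2, 2HK - 2 ≤ 2HK - 2H - 1, and the base is at least 1.
      · exact Real.rpow_le_rpow_of_exponent_le hr (by linarith)
      · exact le_rfl
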